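/- Let $\mathcal{O}\subset\mathbb{R}^3$ be an open set (bounded or unbounded) on which the Poincaré inequality holds: for some $\lambda>0$, $$\lambda\int_{\mathcal{O}}|\psi|^2\,dx\le\int_{\mathcal{O}}|\nabla\psi|^2\,dx\qquad\text{for all }\psi\in H^1_0(\mathcal{O};\mathbb{R}^3).$$ Let $\mathbb{H}$ and $\mathbb{V}$ be the completions of $\{\varphi\in C_c^\infty(\mathcal{O};\mathbb{R}^3):\nabla\cdot\varphi=0\}$ in the $L^2$ norm and in the $H^1$ norm, with $\|u\|_{\mathbb{H}}=\|u\|_{L^2}$ and $\|u\|_{\mathbb{V}}=\|\nabla u\|_{L^2}$. Let $\mathcal{P}$ be the orthogonal projection of $L^2(\mathcal{O};\mathbb{R}^3)$ onto $\mathbb{H}$, let $b(u,v,w)=\sum_{i,j=1}^3\int_{\mathcal{O}}u_i\,\frac{\partial v_j}{\partial x_i}\,w_j\,dx$, and for $N>0$ let $F_N(r)=\min\{1,N/r\}$ for $r>0$ and $F_N(0)=1$. For $g\in L^2(\mathcal{O};\mathbb{R}^3)$ let $\|g\|_{\mathbb{H}^{-1}}=\sup\{\int_{\mathcal{O}}g\cdot\varphi\,dx:\varphi\in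 H_0^1(\mathcal{O};\mathbb{R}^3),\ \|\nabla\varphi\|_{L^2}\le1\}$. Let $\nu>0$, $N>0$, $\tau\in\mathbb{R}$, $u_0\in\mathbb{H}$ and $f\in L^2_{\mathrm{loc}}(\mathbb{R};L^2(\mathcal{O};\mathbb{R}^3))$. Then there is a unique weak solution $u\in C([\tau,\infty);\mathbb{H})\cap L^2_{\mathrm{loc}}(\tau,\infty;\mathbb{V})$ (that is, $u\in L^2(\tau,T;\mathbb{V})$ for every $T>\tau$) of the globally modified Navier–Stokes system $$\frac{du}{dt}+\nu\,\mathrm{A}u+F_N(\|u\|_{L^4(\mathcal{O})})\,\mathrm{B}(u)=\mathcal{P}f,\qquad u(\tau)=u_0,$$ where $\langle\mathrm{A}u,v\rangle=\int_{\mathcal O}\nabla u:\nabla v\,dx$ and $\langle\mathrm{B}(u),v\rangle=b(u,u,v)$. Here a weak solution is a $u$ in this class with $u(\tau)=u_0$ such that, for all $v\in\mathbb{V}$ and $t\ge\tau$, $$(u(t),v)+\nu\int_\tau^t(\nabla u(s),\nabla v)\,ds+\int_\tau^tF_N(\|u(s)\|_{L^4(\mathcal{O})})\,b(u(s),u(s),v)\,ds=(u_0,v)+\int_\tau^t(\mathcal{P}f(s),v)\,ds.$$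 Moreover, for all $t\ge\tau$, $$\|u(t)\|_{\mathbb{H}}^2+\frac{\nu}{2}\int_\tau^te^{-\nu\lambda(t-s)}\|u(s)\|_{\mathbb{V}}^2\,ds\le e^{-\nu\lambda(t-\tau)}\|u_0\|_{\mathbb{H}}^2+\frac{2}{\nu}\int_\tau^te^{-\nu\lambda(t-s)}\|f(s)\|_{\mathbb{H}^{-1}}^2\,ds .$$ -/

import Mathlib

open MeasureTheory TopologicalSpace
open scoped Distributions ContDiff

noncomputable section

namespace GMNS

/-- Three-dimensional Euclidean space. -/
abbrev E3 := EuclideanSpace ℝ (Fin 3)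

/-- Real `3 × 3` arrays with the Euclidean (Frobenius) norm. -/
abbrev M3 := EuclideanSpace ℝ (Fin 3 × Fin 3)

/-- The space `L²(Ω; F)`. -/
abbrev L2 (Ω : Opens E3) (F : Type) [NormedAddCommGroup F] :=
  Lp F 2 (volume.restrict (Ω : Set E3))

/-- The Jacobian array of a vector field: its entry `(i, j)` is
`∂φ_i / ∂x_j`. -/
def jac (φ : E3 → E3) (x : E3) : M3 :=
  WithLp.toLp 2 fun p => fderiv ℝ φ x (EuclideanSpace.single p.2 1) p.1

/-- The divergence of a vector field. -/
def div (φ : E3 → E3) (x : E3) : ℝ := ∑ i, jac φ x (i, i)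

theorem jac_zero : jac 0 = 0 := by
  funext x; ext p; simp [jac]

theorem jac_add (φ ψ : E3 → E3) (hφ : Differentiable ℝ φ) (hψ : Differentiable ℝ ψ) :
    jac (φ + ψ) = jac φ + jac ψ := by
  funext x; ext p; simp [jac, fderiv_add (hφ x) (hψ x)]

theorem jac_smul (c : ℝ) (φ : E3 → E3) (hφ : Differentiable ℝ φ) :
    jac (c • φ) = c • jac φ := by
  funext x; ext p; simp [jac, fderiv_const_smul (hφ x) c]

theorem differentiable_test {Ω : Opens E3} (φ : 𝓓(Ω, E3)) : Differentiable ℝ φ :=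
  φ.contDiff.differentiable (by simp)

/-- The divergence-free test fields `{φ ∈ C_c^∞(Ω; ℝ³) : ∇ · φ = 0}`. -/
def solenoidal (Ω : Opens E3) : Submodule ℝ 𝓓(Ω, E3) where
  carrier := {φ | ∀ x, div φ x = 0}
  zero_mem' := by
    intro x
    have : ((0 : 𝓓(Ω, E3)) : E3 → E3) = 0 := rfl
    simp [div, this, jac_zero]
  add_mem' := by
    intro φ ψ hφ hψ x
    have h : ((φ + ψ : 𝓓(Ω, E3)) : E3 → E3) = (φ : E3 → E3) + ψ := rfl
    have h1 := hφ x
    have h2 := hψ x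
    simp only [div] at h1 h2
    simp [div, h, jac_add _ _ (differentiable_test φ) (differentiable_test ψ),
      Finset.sum_add_distrib, h1, h2]
  smul_mem' := by
    intro c φ hφ x
    have h : ((c • φ : 𝓓(Ω, E3)) : E3 → E3) = c • (φ : E3 → E3) := rfl
    have h1 := hφ x
    simp only [div] at h1
    simp [div, h, jac_smul _ _ (differentiable_test φ), ← Finset.mul_sum, h1]

/-- The Hilbert space `L²(Ω; ℝ³) × L²(Ω; ℝ^{3×3})`, with the norm
`‖(u, g)‖² = ‖u‖² + ‖g‖²`. It contains an isometric copy `φ ↦ (φ, ∇φ)` of the test fields with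
the `H¹` norm. -/
abbrev Pairs (Ω : Opens E3) := WithLp 2 (L2 Ω E3 × L2 Ω M3)

/-- The classes in `L²(Ω; ℝ³)` of the elements of a space `S` of test fields. -/
def valuesOf {Ω : Opens E3} (S : Submodule ℝ 𝓓(Ω, E3)) : Submodule ℝ (L2 Ω E3) where
  carrier := {w | ∃ φ ∈ S, w =ᵐ[volume.restrict (Ω : Set E3)] φ}
  zero_mem' := ⟨0, S.zero_mem, Lp.coeFn_zero _ _ _⟩
  add_mem' := by
    rintro a b ⟨φ, hφ, ha⟩ ⟨ψ, hψ, hb⟩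
    exact ⟨φ + ψ, S.add_mem hφ hψ, (Lp.coeFn_add _ _).trans (ha.add hb)⟩
  smul_mem' := by
    rintro c a ⟨φ, hφ, ha⟩
    exact ⟨c • φ, S.smul_mem c hφ, (Lp.coeFn_smul _ _).trans (ha.const_smul c)⟩

/-- The pairs `(φ, ∇φ)`, for `φ` in a space `S` of test fields. -/
def graphOf {Ω : Opens E3} (S : Submodule ℝ 𝓓(Ω, E3)) : Submodule ℝ (Pairs Ω) where
  carrier := {w | ∃ φ ∈ S, w.fst =ᵐ[volume.restrict (Ω : Set E3)] φ ∧
    w.snd =ᵐ[volume.restrict (Ω : Set E3)] jac φ}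
  zero_mem' := by
    refine ⟨0, S.zero_mem, Lp.coeFn_zero _ _ _, ?_⟩
    have : ((0 : 𝓓(Ω, E3)) : E3 → E3) = 0 := rfl
    rw [this, jac_zero]
    exact Lp.coeFn_zero _ _ _
  add_mem' := by
    rintro a b ⟨φ, hφ, ha, ha'⟩ ⟨ψ, hψ, hb, hb'⟩
    refine ⟨φ + ψ, S.add_mem hφ hψ, (Lp.coeFn_add _ _).trans (ha.add hb), ?_⟩
    have h : ((φ + ψ : 𝓓(Ω, E3)) : E3 → E3) = (φ : E3 → E3) + ψ := rfl
    rw [h, jac_add _ _ (differentiable_test φ) (differentiable_test ψ)]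
    exact (Lp.coeFn_add _ _).trans (ha'.add hb')
  smul_mem' := by
    rintro c a ⟨φ, hφ, ha, ha'⟩
    refine ⟨c • φ, S.smul_mem c hφ, (Lp.coeFn_smul _ _).trans (ha.const_smul c), ?_⟩
    have h : ((c • φ : 𝓓(Ω, E3)) : E3 → E3) = c • (φ : E3 → E3) := rfl
    rw [h, jac_smul _ _ (differentiable_test φ)]
    exact (Lp.coeFn_smul _ _).trans (ha'.const_smul c)

/-- The space `H`: the completion of the divergence-free test fields in the `L²` norm. -/
abbrev H (Ω : Opens E3) : Submodule ℝ (L2 Ω E3) := (valuesOf (solenoidal Ω)).topologicalClosure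

/-- The space `V`: the completion of the divergence-free test fields in the `H¹` norm. An element
is a pair consisting of a field and its weak gradient. -/
abbrev V (Ω : Opens E3) : Submodule ℝ (Pairs Ω) := (graphOf (solenoidal Ω)).topologicalClosure

/-- The space `H¹₀(Ω; ℝ³)`: the completion of all test fields in the `H¹` norm. -/
abbrev H10 (Ω : Opens E3) : Submodule ℝ (Pairs Ω) :=
  (graphOf (⊤ : Submodule ℝ 𝓓(Ω, E3))).topologicalClosure

/-- The Helmholtz projection of `L²(Ω; ℝ³)` onto `H`. -/
def helmholtz (Ω : Opens E3) : L2 Ω E3 →L[ℝ] L2 Ω E3 := (H Ω).starProjection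

/-- The Poincaré inequality `lam ∫ |ψ|² ≤ ∫ |∇ψ|²` on `H¹₀(Ω; ℝ³)`. -/
def PoincareInequality (Ω : Opens E3) (lam : ℝ) : Prop :=
  ∀ ψ : H10 Ω, lam * ‖ψ.1.fst‖ ^ 2 ≤ ‖ψ.1.snd‖ ^ 2

/-- The `H⁻¹(Ω)` norm of a field in `L²(Ω; ℝ³)`: the dual norm of `φ ↦ ∫ g · φ` on `H¹₀(Ω; ℝ³)`,
normed by `‖∇φ‖_{L²}`. -/
def negNorm (Ω : Opens E3) (g : L2 Ω E3) : ℝ :=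
  sSup {r | ∃ φ : H10 Ω, ‖φ.1.snd‖ ≤ 1 ∧ r = inner ℝ g φ.1.fst}

/-- The cut-off function `min {1, N / r}` for `r > 0`, extended by its limit `1` at `r = 0`. -/
def cutoff (N r : ℝ) : ℝ := if r = 0 then 1 else min 1 (N / r)

/-- The `L⁴(Ω)` norm. It is finite for the fields of `V`. -/
def normL4 {Ω : Opens E3} (u : L2 Ω E3) : ℝ :=
  (eLpNorm u 4 (volume.restrict (Ω : Set E3))).toReal

/-- The trilinear form `b(u, v, w) = ∑ i j, ∫ u_i (∂v_j / ∂x_i) w_j`. -/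
def trilinear {Ω : Opens E3} (u v w : V Ω) : ℝ :=
  ∑ i, ∑ j, ∫ x in (Ω : Set E3), u.1.fst x i * v.1.snd x (j, i) * w.1.fst x j

/-- `u` is a weak solution on `[τ, ∞)` of
`du/dt + ν A u + F_N(‖u‖_{L⁴}) B(u) = P f`, `u(τ) = u₀`, in the class
`C([τ, ∞); H) ∩ L²_loc(τ, ∞; V)`. Here `U t` is the element of `V` that `u t` is, together with its
gradient, for almost every `t`. The equation in `V*` is tested with the elements of `V` and
integrated in time. -/
structure IsWeakSolution (Ω : Opens E3) (ν N τ : ℝ) (f : ℝ → L2 Ω E3) (u₀ : H Ω)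
    (u : ℝ → H Ω) (U : ℝ → V Ω) : Prop where
  continuousOn : ContinuousOn u (Set.Ici τ)
  memLp : ∀ T, MemLp U 2 (volume.restrict (Set.Ioc τ T))
  ae_eq : ∀ᵐ t ∂volume.restrict (Set.Ioi τ), (u t : L2 Ω E3) = (U t).1.fst
  initial : u τ = u₀
  equation : ∀ v : V Ω, ∀ t, τ ≤ t →
    inner ℝ (u t : L2 Ω E3) v.1.fst
        + ν * (∫ s in τ..t, inner ℝ (U s).1.snd v.1.snd)
        + (∫ s in τ..t, cutoff N (normL4 (U s).1.fst) * trilinear (U s) (U s) v)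
      = inner ℝ (u₀ : L2 Ω E3) v.1.fst + ∫ s in τ..t, inner ℝ (helmholtz Ω (f s)) v.1.fst

end GMNS

end

/-! Equip `V` with its full H¹ inner product and let `j : V → H` be the inclusion. Functionals on
`V` are represented by elements of `V`, so the system reads `u' + ν A u = g - G(u)`, where `A` is
the Riesz map, `g` represents the force and `G(u)` represents `F_N(‖u‖) B(u) - ν u`; the last term
undoes the zero-order part of `A`.

The linear problem `u' + ν A u = h` is solved without a Galerkin basis. The primitive of an L²
function with values in `V` is an exact solution for its own data and obeys the energy equality by
the product rule. Such data are dense (`exists_strongData_near`), and the energy estimate carries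
the limit in C(H) ∩ L²(V). Uniqueness (`IsLinearSolution.eq_zero`) comes from testing the
time-integrated equation with the solution at the current time, so every weak solution inherits the
energy equality.

The semilinear problem is a fixed point problem. By antisymmetry of `b`, the nonlinear term is minus
the adjoint of the gradient applied to `F_N(‖u‖_{L⁴}) u ⊗ u`. The cut-off makes this expression
globally Lipschitz from L⁴ to L² (`norm_cutoff_smul_sub_le`), and Ladyzhenskaya's inequality bounds
the squared L⁴ norm by a small multiple of the squared H¹ norm plus a large multiple of the squared
L² norm. Hence `G` is of lower order in the sense of `IsLowerOrder`, and the solution map contracts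
an exponentially weighted energy norm (`IsLowerOrder.exists_contraction`). The weight works on every
interval, so local solutions glue to a global one.

For the estimate, `b(u, u, u) = 0` removes the nonlinearity from the energy equality. Young's
inequality absorbs the force, the Poincaré inequality supplies the decay rate `ν λ`, and the
integrating factor `exp(ν λ t)` finishes. -/

namespace GMNS

open Set Filter Topology
open scoped RealInnerProductSpace ENNReal NNReal

/-! ### Product rule and differentiation for vector-valued primitives. -/

section Calculus

variable {K : Type*} [NormedAddCommGroup K] [InnerProductSpace ℝ K] [CompleteSpace K]

theorem absolutelyContinuous_of_dist_le {X Y : Type*} [PseudoMetricSpace X] [PseudoMetricSpace Y]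
    {f : ℝ → X} {m : ℝ → Y} {a b : ℝ} (hm : AbsolutelyContinuousOnInterval m a b) (C : ℝ)
    (h : ∀ x ∈ uIcc a b, ∀ y ∈ uIcc a b, dist (f x) (f y) ≤ C * dist (m x) (m y)) :
    AbsolutelyContinuousOnInterval f a b := by
  have h1 := Filter.Tendsto.const_mul C hm
  rw [mul_zero] at h1
  refine squeeze_zero' (Eventually.of_forall fun E => Finset.sum_nonneg fun i _ => dist_nonneg)
    ?_ h1
  filter_upwards [mem_inf_of_right (mem_principal_self _)] with E hE
  rw [Finset.mul_sum]
  exact Finset.sum_le_sum fun i hi => h _ (hE.1 i hi).1 _ (hE.1 i hi).2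

theorem dist_integral_le {K : Type*} [NormedAddCommGroup K] [NormedSpace ℝ K] {f : ℝ → K} {m : ℝ → ℝ} {a b : ℝ}
    (hf : IntervalIntegrable f volume a b) (hm : IntervalIntegrable m volume a b)
    (hfm : ∀ x, ‖f x‖ ≤ m x) (c : K) :
    ∀ x ∈ uIcc a b, ∀ y ∈ uIcc a b, dist (c + ∫ s in a..x, f s) (c + ∫ s in a..y, f s) ≤
      dist (∫ s in a..x, m s) (∫ s in a..y, m s) := by
  intro x hx y hy
  have hs : ∀ z ∈ uIcc a b, uIcc a z ⊆ uIcc a b := fun z hz => uIcc_subset_uIcc left_mem_uIcc hz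
  rw [dist_add_left, dist_eq_norm, Real.dist_eq,
    intervalIntegral.integral_interval_sub_left (hf.mono_set (hs x hx)) (hf.mono_set (hs y hy)),
    intervalIntegral.integral_interval_sub_left (hm.mono_set (hs x hx)) (hm.mono_set (hs y hy))]
  exact intervalIntegral.norm_integral_le_abs_of_norm_le (ae_of_all _ fun s => hfm s)
    (hm.mono_set (uIcc_subset_uIcc hy hx))

/-- Only the scalar function `⟪F, G⟫` has to be absolutely continuous. Its increments are dominated
by those of the primitive of `‖f‖ + ‖g‖`, because `F` and `G` are bounded. Its derivative is found
almost everywhere from Lebesgue differentiation of both primitives. -/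
theorem inner_integral_eq {f g : ℝ → K} {a b : ℝ} (hf : IntervalIntegrable f volume a b)
    (hg : IntervalIntegrable g volume a b) (c d : K) {F G : ℝ → K}
    (hF : ∀ t ∈ uIcc a b, F t = c + ∫ s in a..t, f s)
    (hG : ∀ t ∈ uIcc a b, G t = d + ∫ s in a..t, g s) :
    ⟪F b, G b⟫ = ⟪c, d⟫ + ∫ s in a..b, (⟪f s, G s⟫ + ⟪F s, g s⟫) := by
  set m : ℝ → ℝ := fun s => ‖f s‖ + ‖g s‖
  have hm : IntervalIntegrable m volume a b := hf.norm.add hg.norm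
  have hmac := hm.absolutelyContinuousOnInterval_intervalIntegral (c := a) left_mem_uIcc
  have hFd : ∀ x ∈ uIcc a b, ∀ y ∈ uIcc a b, dist (F x) (F y) ≤
      dist (∫ s in a..x, m s) (∫ s in a..y, m s) := by
    intro x hx y hy
    rw [hF x hx, hF y hy]
    exact dist_integral_le hf hm (fun s => by simp [m]) c x hx y hy
  have hGd : ∀ x ∈ uIcc a b, ∀ y ∈ uIcc a b, dist (G x) (G y) ≤
      dist (∫ s in a..x, m s) (∫ s in a..y, m s) := by
    intro x hx y hy
    rw [hG x hx, hG y hy]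
    exact dist_integral_le hg hm (fun s => by simp [m]) d x hx y hy
  have hFac := absolutelyContinuous_of_dist_le (f := F) hmac 1 (fun x hx y hy => by
    rw [one_mul]; exact hFd x hx y hy)
  have hGac := absolutelyContinuous_of_dist_le (f := G) hmac 1 (fun x hx y hy => by
    rw [one_mul]; exact hGd x hx y hy)
  obtain ⟨CF, hCF⟩ := hFac.exists_bound
  obtain ⟨CG, hCG⟩ := hGac.exists_bound
  have hac : AbsolutelyContinuousOnInterval (fun t => ⟪F t, G t⟫) a b := by
    refine absolutelyContinuous_of_dist_le hmac (CF + CG) fun x hx y hy => ?_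
    have e : ⟪F x, G x⟫ - ⟪F y, G y⟫ = ⟪F x, G x - G y⟫ + ⟪F x - F y, G y⟫ := by
      rw [inner_sub_right, inner_sub_left]; ring
    have h1 := hFd x hx y hy
    have h2 := hGd x hx y hy
    rw [dist_eq_norm (F x)] at h1
    rw [dist_eq_norm (G x)] at h2
    calc dist ⟪F x, G x⟫ ⟪F y, G y⟫
        = |⟪F x, G x - G y⟫ + ⟪F x - F y, G y⟫| := by rw [Real.dist_eq, e]
      _ ≤ ‖F x‖ * ‖G x - G y‖ + ‖F x - F y‖ * ‖G y‖ :=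
        (abs_add_le _ _).trans (add_le_add (abs_real_inner_le_norm _ _)
          (abs_real_inner_le_norm _ _))
      _ ≤ CF * dist (∫ s in a..x, m s) (∫ s in a..y, m s)
          + dist (∫ s in a..x, m s) (∫ s in a..y, m s) * CG := by
        have h0 := (norm_nonneg _).trans (hCF x hx)
        gcongr
        · exact hCF x hx
        · exact hCG y hy
      _ = _ := by ring
  have h := hac.integral_deriv_eq_sub
  have ha : ⟪F a, G a⟫ = ⟪c, d⟫ := by
    rw [hF a left_mem_uIcc, hG a left_mem_uIcc]; simp
  simp only [ha] at h
  rw [← sub_eq_iff_eq_add', ← h]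
  -- Away from the endpoints, the formulas for `F` and `G` hold in a neighbourhood and can be
  -- differentiated.
  have hne : ∀ z : ℝ, ∀ᵐ x, x ≠ z := fun z => by simp [ae_iff, measure_singleton]
  refine intervalIntegral.integral_congr_ae ?_
  filter_upwards [hf.ae_hasDerivAt_integral, hg.ae_hasDerivAt_integral, hne a, hne b]
    with x hfx hgx hxa hxb hx
  have hx' := uIoc_subset_uIcc hx
  have hnhds : uIcc a b ∈ 𝓝 x := by
    rw [mem_nhds_iff]
    refine ⟨uIoo a b, uIoo_subset_uIcc_self, isOpen_Ioo, ?_⟩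
    rw [uIoc, mem_Ioc] at hx
    refine ⟨hx.1, lt_of_le_of_ne hx.2 ?_⟩
    rcases max_choice a b with h | h <;> simp_all
  have h1 : HasDerivAt F (f x) x := by
    refine ((hfx hx' a left_mem_uIcc).const_add c).congr_of_eventuallyEq ?_
    filter_upwards [hnhds] with y hy using hF y hy
  have h2 : HasDerivAt G (g x) x := by
    refine ((hgx hx' a left_mem_uIcc).const_add d).congr_of_eventuallyEq ?_
    filter_upwards [hnhds] with y hy using hG y hy
  rw [(h1.inner ℝ h2).deriv, add_comm]

theorem exp_mul_eq {y φ : ℝ → ℝ} {a b y₀ : ℝ} (c : ℝ) (hφ : IntervalIntegrable φ volume a b)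
    (hy : ∀ t ∈ uIcc a b, y t = y₀ + ∫ s in a..t, φ s) :
    Real.exp (c * b) * y b = Real.exp (c * a) * y₀ +
      ∫ s in a..b, Real.exp (c * s) * (φ s + c * y s) := by
  have hd : ∀ t, HasDerivAt (fun t => Real.exp (c * t)) (Real.exp (c * t) * c) t := fun t => by
    simpa using ((hasDerivAt_id t).const_mul c).exp
  have hi : ∀ t, IntervalIntegrable (fun s => Real.exp (c * s) * c) volume a t := fun t =>
    Continuous.intervalIntegrable (by fun_prop) _ _
  have := inner_integral_eq (hi b) hφ (Real.exp (c * a)) y₀ (F := fun t => Real.exp (c * t))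
    (G := y) (fun t _ => by
      rw [intervalIntegral.integral_eq_sub_of_hasDerivAt (fun x _ => hd x) (hi t)]; ring) hy
  simp only [RCLike.inner_apply, conj_trivial] at this
  rw [mul_comm, this, mul_comm y₀]
  congr 1
  refine intervalIntegral.integral_congr fun s _ => ?_
  ring

theorem ae_eq_zero_of_integral_eq_zero {f : ℝ → K} {a b : ℝ} (hab : a ≤ b)
    (hf : IntervalIntegrable f volume a b) (h : ∀ t ∈ Icc a b, ∫ s in a..t, f s = 0) :
    ∀ᵐ t ∂volume.restrict (Ioc a b), f t = 0 := by
  rw [ae_restrict_iff' measurableSet_Ioc]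
  have hne : ∀ z : ℝ, ∀ᵐ x, x ≠ z := fun z => by simp [ae_iff, measure_singleton]
  filter_upwards [hf.ae_hasDerivAt_integral, hne b] with x hx hxb hxab
  have h1 := hx (by rw [uIcc_of_le hab]; exact Ioc_subset_Icc_self hxab) a left_mem_uIcc
  have hnhds : Icc a b ∈ 𝓝 x := Icc_mem_nhds hxab.1 (lt_of_le_of_ne hxab.2 hxb)
  refine h1.unique ((hasDerivAt_const x (0 : K)).congr_of_eventuallyEq ?_)
  filter_upwards [hnhds] with y hy using h y hy

end Calculus

/-! ### Square-integrable functions of time. -/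

section Toolkit

variable {K : Type*} [NormedAddCommGroup K] [InnerProductSpace ℝ K] {a b t : ℝ}

theorem intervalIntegrable_of_mem_Icc {K : Type*} [NormedAddCommGroup K] {φ : ℝ → K} (hφ : Integrable φ (volume.restrict (Ioc a b)))
    (ht : t ∈ Icc a b) : IntervalIntegrable φ volume a t := by
  rw [intervalIntegrable_iff_integrableOn_Ioc_of_le ht.1]
  exact IntegrableOn.mono_set hφ (Ioc_subset_Ioc_right ht.2)

theorem memLp_integrable_inner {α : Type*} [MeasurableSpace α] {μ : Measure α} {F G : α → K}
    (hF : MemLp F 2 μ) (hG : MemLp G 2 μ) : Integrable (fun s => ⟪F s, G s⟫) μ :=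
  memLp_one_iff_integrable.1 ((innerSL ℝ : K →L[ℝ] K →L[ℝ] ℝ).memLp_of_bilin 1 hF hG)

theorem memLp_integrable_norm_sq {K : Type*} [NormedAddCommGroup K] {α : Type*} [MeasurableSpace α] {μ : Measure α} {F : α → K}
    (hF : MemLp F 2 μ) : Integrable (fun s => ‖F s‖ ^ 2) μ :=
  hF.norm.integrable_sq

theorem Lp_norm_sq {α : Type*} [MeasurableSpace α] {μ : Measure α} (F : Lp K 2 μ) :
    ‖F‖ ^ 2 = ∫ s, ‖F s‖ ^ 2 ∂μ := by
  rw [← real_inner_self_eq_norm_sq, L2.inner_def]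
  simp only [real_inner_self_eq_norm_sq]

theorem toLp_norm_sq {α : Type*} [MeasurableSpace α] {μ : Measure α} {F : α → K}
    (hF : MemLp F 2 μ) : ‖hF.toLp F‖ ^ 2 = ∫ s, ‖F s‖ ^ 2 ∂μ := by
  rw [Lp_norm_sq]
  exact integral_congr_ae (hF.coeFn_toLp.mono fun s hs => by simp only [hs])

theorem integral_congr_Icc {φ ψ : ℝ → ℝ} (h : ∀ᵐ s ∂volume.restrict (Ioc a b), φ s = ψ s)
    (ht : t ∈ Icc a b) : ∫ s in a..t, φ s = ∫ s in a..t, ψ s := by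
  rw [intervalIntegral.integral_of_le ht.1, intervalIntegral.integral_of_le ht.1]
  exact integral_congr_ae (ae_restrict_of_ae_restrict_of_subset (Ioc_subset_Ioc_right ht.2) h)

theorem integral_mono_Icc {φ ψ : ℝ → ℝ} (hφ : Integrable φ (volume.restrict (Ioc a b)))
    (hψ : Integrable ψ (volume.restrict (Ioc a b)))
    (h : ∀ᵐ s ∂volume.restrict (Ioc a b), φ s ≤ ψ s)
    (ht : t ∈ Icc a b) : ∫ s in a..t, φ s ≤ ∫ s in a..t, ψ s := by
  rw [intervalIntegral.integral_of_le ht.1, intervalIntegral.integral_of_le ht.1]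
  have hs : Ioc a t ⊆ Ioc a b := Ioc_subset_Ioc_right ht.2
  exact integral_mono_ae (IntegrableOn.mono_set hφ hs) (IntegrableOn.mono_set hψ hs)
    (ae_restrict_of_ae_restrict_of_subset hs h)

theorem integral_le_of_mem_Icc {φ : ℝ → ℝ} (hφ : Integrable φ (volume.restrict (Ioc a b)))
    (h : ∀ s, 0 ≤ φ s) (ht : t ∈ Icc a b) :
    ∫ s in a..t, φ s ≤ ∫ s in Ioc a b, φ s := by
  rw [intervalIntegral.integral_of_le ht.1]
  exact setIntegral_mono_set hφ (ae_of_all _ h) (Ioc_subset_Ioc_right ht.2).eventuallyLE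

/-- Restriction from L²(a, b) to L²(a, t) is a continuous linear map, and the integral is the inner
product of the restrictions. -/
theorem tendsto_integral_inner {F G : ℕ → Lp K 2 (volume.restrict (Ioc a b))}
    {F' G' : Lp K 2 (volume.restrict (Ioc a b))} (hF : Tendsto F atTop (𝓝 F'))
    (hG : Tendsto G atTop (𝓝 G')) (ht : t ∈ Icc a b) :
    Tendsto (fun n => ∫ s in a..t, ⟪F n s, G n s⟫) atTop (𝓝 (∫ s in a..t, ⟪F' s, G' s⟫)) := by
  set R := LpToLpRestrictCLM ℝ K ℝ (volume.restrict (Ioc a b)) 2 (Ioc a t)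
  have key : ∀ X Y : Lp K 2 (volume.restrict (Ioc a b)),
      ⟪R X, R Y⟫ = ∫ s in a..t, ⟪X s, Y s⟫ := by
    intro X Y
    rw [L2.inner_def, intervalIntegral.integral_of_le ht.1]
    have hr : (volume.restrict (Ioc a b)).restrict (Ioc a t) = volume.restrict (Ioc a t) :=
      Measure.restrict_restrict_of_subset (Ioc_subset_Ioc_right ht.2)
    calc _ = ∫ s, ⟪X s, Y s⟫ ∂((volume.restrict (Ioc a b)).restrict (Ioc a t)) := by
          refine integral_congr_ae ?_
          filter_upwards [LpToLpRestrictCLM_coeFn ℝ (Ioc a t) X,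
            LpToLpRestrictCLM_coeFn ℝ (Ioc a t) Y] with s h1 h2
          rw [h1, h2]
      _ = _ := by rw [hr]
  simp only [← key]
  exact ((R.continuous.tendsto _).comp hF).inner ((R.continuous.tendsto _).comp hG)

end Toolkit

/-! ### The abstract linear problem and its uniqueness. -/

section Linear

variable {V H : Type*} [NormedAddCommGroup V] [InnerProductSpace ℝ V]
  [NormedAddCommGroup H] [InnerProductSpace ℝ H]

/-- `u ∈ C([a, b]; H) ∩ L²(a, b; V)`, with `U` its `V`-valued version, is a weak solution of
`u' + ν A u = h`, `u(a) = u₀`, where `⟨A u, v⟩` is the inner product of `V` and `j : V → H`. -/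
structure IsLinearSolution (j : V →L[ℝ] H) (ν a b : ℝ) (u₀ : H) (h : ℝ → V) (u : ℝ → H)
    (U : ℝ → V) : Prop where
  continuousOn : ContinuousOn u (Icc a b)
  memLp : MemLp U 2 (volume.restrict (Ioc a b))
  ae_eq : ∀ᵐ t ∂volume.restrict (Ioc a b), u t = j (U t)
  initial : u a = u₀
  equation : ∀ v, ∀ t ∈ Icc a b,
    ⟪u t, j v⟫ + ν * ∫ s in a..t, ⟪U s, v⟫ = ⟪u₀, j v⟫ + ∫ s in a..t, ⟪h s, v⟫

variable {j : V →L[ℝ] H} {ν a b : ℝ}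

theorem IsLinearSolution.sub {u₀ u₀' : H} {h h' : ℝ → V} {u u' : ℝ → H} {U U' : ℝ → V}
    (s : IsLinearSolution j ν a b u₀ h u U) (s' : IsLinearSolution j ν a b u₀' h' u' U')
    (hh : MemLp h 2 (volume.restrict (Ioc a b))) (hh' : MemLp h' 2 (volume.restrict (Ioc a b))) :
    IsLinearSolution j ν a b (u₀ - u₀') (h - h') (u - u') (U - U') where
  continuousOn := s.continuousOn.sub s'.continuousOn
  memLp := s.memLp.sub s'.memLp
  ae_eq := by
    filter_upwards [s.ae_eq, s'.ae_eq] with t h1 h2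
    simp [h1, h2]
  initial := by simp [s.initial, s'.initial]
  equation := fun v t ht => by
    have key : ∀ F G : ℝ → V, MemLp F 2 (volume.restrict (Ioc a b)) →
        MemLp G 2 (volume.restrict (Ioc a b)) →
        ∫ r in a..t, ⟪(F - G) r, v⟫ = (∫ r in a..t, ⟪F r, v⟫) - ∫ r in a..t, ⟪G r, v⟫ := by
      intro F G hF hG
      rw [← intervalIntegral.integral_sub
        (intervalIntegrable_of_mem_Icc ((hF.integrable one_le_two).inner_const v) ht)
        (intervalIntegrable_of_mem_Icc ((hG.integrable one_le_two).inner_const v) ht)]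
      simp only [Pi.sub_apply, inner_sub_left]
    rw [key _ _ s.memLp s'.memLp, key _ _ hh hh', Pi.sub_apply, inner_sub_left, inner_sub_left]
    linear_combination s.equation v t ht - s'.equation v t ht

variable [CompleteSpace V]

/-- With `Q` the primitive of `U`, the integrated equation tested with `U t` says `‖u‖² = -ν ⟪Q,
U⟫`, which is `-ν/2` times the derivative of `‖Q‖²`. Integrating, a nonnegative quantity equals
`-ν/2 ‖Q t‖²`, so `Q` vanishes. No energy equality for `u` is presupposed. -/
theorem IsLinearSolution.eq_zero {u : ℝ → H} {U : ℝ → V} (hν : 0 < ν) (hab : a ≤ b)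
    (s : IsLinearSolution j ν a b 0 0 u U) :
    (∀ t ∈ Icc a b, u t = 0) ∧ ∀ᵐ t ∂volume.restrict (Ioc a b), U t = 0 := by
  have hUi := s.memLp.integrable one_le_two
  have hI : IntervalIntegrable U volume a b :=
    intervalIntegrable_of_mem_Icc hUi (right_mem_Icc.2 hab)
  set Q : ℝ → V := fun t => ∫ r in a..t, U r
  have hpt : ∀ᵐ t ∂volume.restrict (Ioc a b), ‖u t‖ ^ 2 = - (ν * ⟪Q t, U t⟫) := by
    filter_upwards [s.ae_eq, ae_restrict_mem measurableSet_Ioc] with t h1 h2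
    have h3 := s.equation (U t) t (Ioc_subset_Icc_self h2)
    rw [← h1, real_inner_self_eq_norm_sq] at h3
    have h4 : ∫ r in a..t, ⟪U r, U t⟫ = ⟪Q t, U t⟫ := by
      have hc : (fun r => ⟪U r, U t⟫) = fun r => ⟪U t, U r⟫ :=
        funext fun r => real_inner_comm _ _
      rw [hc, real_inner_comm]
      rw [intervalIntegral.integral_of_le h2.1.le,
        integral_inner (IntegrableOn.mono_set hUi (Ioc_subset_Ioc_right h2.2))]
      simp only [Q]
      rw [intervalIntegral.integral_of_le h2.1.le]
    rw [h4] at h3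
    simp only [inner_zero_left, Pi.zero_apply, intervalIntegral.integral_zero] at h3
    linarith
  have hQ : ∀ t ∈ Icc a b, Q t = 0 := by
    intro t ht
    have hQ1 := inner_integral_eq (intervalIntegrable_of_mem_Icc hUi ht)
      (intervalIntegrable_of_mem_Icc hUi ht) 0 0 (F := Q) (G := Q) (fun t _ => by simp [Q])
      (fun t _ => by simp [Q])
    have h1 : ∫ r in a..t, ‖u r‖ ^ 2 = ∫ r in a..t, - (ν / 2) * (⟪U r, Q r⟫ + ⟪Q r, U r⟫) := by
      refine integral_congr_Icc (hpt.mono fun r hr => ?_) ht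
      rw [hr, real_inner_comm (Q r)]
      ring
    rw [intervalIntegral.integral_const_mul] at h1
    rw [inner_zero_left, zero_add] at hQ1
    rw [← hQ1, real_inner_self_eq_norm_sq] at h1
    have h2 : 0 ≤ ∫ r in a..t, ‖u r‖ ^ 2 :=
      intervalIntegral.integral_nonneg ht.1 fun _ _ => sq_nonneg _
    have h3 : ‖Q t‖ ^ 2 ≤ 0 := by
      by_contra hc
      push Not at hc
      have := mul_pos hν hc
      linarith
    exact norm_eq_zero.1 (pow_eq_zero_iff two_ne_zero |>.1 (le_antisymm h3 (sq_nonneg _)))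
  have hU := ae_eq_zero_of_integral_eq_zero hab hI hQ
  refine ⟨fun t ht => ?_, hU⟩
  -- On a one-point interval the almost-everywhere information is void, and the initial condition is
  -- used instead.
  rcases eq_or_lt_of_le hab with rfl | hlt
  · rw [le_antisymm ht.2 ht.1, s.initial]
  · refine Measure.eqOn_Icc_of_ae_eq volume hlt.ne (f := u) (g := fun _ => 0) ?_ s.continuousOn
      continuousOn_const ht
    rw [← Measure.restrict_congr_set Ioc_ae_eq_Icc]
    filter_upwards [s.ae_eq, hU] with t h1 h2
    rw [h1, h2, map_zero]

theorem IsLinearSolution.unique {u₀ : H} {h : ℝ → V} {u u' : ℝ → H} {U U' : ℝ → V} (hν : 0 < ν)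
    (hab : a ≤ b) (s : IsLinearSolution j ν a b u₀ h u U) (s' : IsLinearSolution j ν a b u₀ h u' U')
    (hh : MemLp h 2 (volume.restrict (Ioc a b))) :
    (∀ t ∈ Icc a b, u t = u' t) ∧ U =ᵐ[volume.restrict (Ioc a b)] U' := by
  have h1 := s.sub s' hh hh
  rw [sub_self, sub_self] at h1
  obtain ⟨h2, h3⟩ := h1.eq_zero hν hab
  exact ⟨fun t ht => sub_eq_zero.1 (h2 t ht), h3.mono fun t ht => sub_eq_zero.1 ht⟩

end Linear

/-! ### Explicit solutions of the linear problem and density of their data. -/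

section LinearExistence

variable {V H : Type*} [NormedAddCommGroup V] [InnerProductSpace ℝ V]
  [NormedAddCommGroup H] [InnerProductSpace ℝ H] {j : V →L[ℝ] H} {ν a b : ℝ}

/-- The field `t ↦ α + ∫ₐᵗ γ`. -/
noncomputable def strongField (a : ℝ) (α : V) (γ : ℝ → V) (t : ℝ) : V := α + ∫ s in a..t, γ s

theorem integrable_of_memLp_two {V : Type*} [NormedAddCommGroup V] {γ : ℝ → V} (hγ : MemLp γ 2 (volume.restrict (Ioc a b))) :
    Integrable γ (volume.restrict (Ioc a b)) := hγ.integrable one_le_two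

theorem continuousOn_strongField (hab : a ≤ b) (α : V) {γ : ℝ → V}
    (hγ : MemLp γ 2 (volume.restrict (Ioc a b))) : ContinuousOn (strongField a α γ) (Icc a b) := by
  have h := intervalIntegral.continuousOn_primitive_interval' (b₁ := a) (b₂ := b) (a := a)
    (intervalIntegrable_of_mem_Icc (integrable_of_memLp_two hγ) (right_mem_Icc.2 hab)) left_mem_uIcc
  rw [uIcc_of_le hab] at h
  exact continuousOn_const.add h

theorem memLp_of_continuousOn {V : Type*} [NormedAddCommGroup V] {F : ℝ → V} (hF : ContinuousOn F (Icc a b)) :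
    MemLp F 2 (volume.restrict (Ioc a b)) := by
  obtain ⟨C, hC⟩ := isCompact_Icc.exists_bound_of_continuousOn hF
  refine MemLp.of_bound ((hF.mono Ioc_subset_Icc_self).aestronglyMeasurable measurableSet_Ioc) C ?_
  filter_upwards [ae_restrict_mem measurableSet_Ioc] with t ht using hC t (Ioc_subset_Icc_self ht)

theorem memLp_strongField (hab : a ≤ b) (α : V) {γ : ℝ → V}
    (hγ : MemLp γ 2 (volume.restrict (Ioc a b))) :
    MemLp (strongField a α γ) 2 (volume.restrict (Ioc a b)) :=
  memLp_of_continuousOn (continuousOn_strongField hab α hγ)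

theorem strongField_sub {α α' : V} {γ γ' : ℝ → V} (hγ : MemLp γ 2 (volume.restrict (Ioc a b)))
    (hγ' : MemLp γ' 2 (volume.restrict (Ioc a b))) {t : ℝ} (ht : t ∈ Icc a b) :
    strongField a (α - α') (γ - γ') t = strongField a α γ t - strongField a α' γ' t := by
  have h := intervalIntegral.integral_sub
    (intervalIntegrable_of_mem_Icc (integrable_of_memLp_two hγ) ht)
    (intervalIntegrable_of_mem_Icc (integrable_of_memLp_two hγ') ht)
  simp only [strongField, Pi.sub_apply, h]
  abel

/-- The energy equality of the linear problem. -/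
def EnergyEquality {V H : Type*} [NormedAddCommGroup V]
    [InnerProductSpace ℝ V] [NormedAddCommGroup H] (ν a b : ℝ) (u₀ : H) (h : ℝ → V) (u : ℝ → H) (U : ℝ → V) : Prop :=
  ∀ t ∈ Icc a b, ‖u t‖ ^ 2 + 2 * ν * ∫ s in a..t, ⟪U s, U s⟫
    = ‖u₀‖ ^ 2 + 2 * ∫ s in a..t, ⟪h s, U s⟫

/-- Young's inequality `2⟪h, U⟫ ≤ ν‖U‖² + ν⁻¹‖h‖²` spends half of the dissipation on the data. -/
theorem EnergyEquality.estimate {H : Type*} [NormedAddCommGroup H] {u₀ : H} {h : ℝ → V} {u : ℝ → H} {U : ℝ → V} (hν : 0 < ν)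
    (e : EnergyEquality ν a b u₀ h u U) (hh : MemLp h 2 (volume.restrict (Ioc a b)))
    (hU : MemLp U 2 (volume.restrict (Ioc a b))) {t : ℝ} (ht : t ∈ Icc a b) :
    ‖u t‖ ^ 2 + ν * ∫ s in a..t, ‖U s‖ ^ 2 ≤ ‖u₀‖ ^ 2 + ν⁻¹ * ∫ s in a..t, ‖h s‖ ^ 2 := by
  have h1 := e t ht
  simp only [real_inner_self_eq_norm_sq] at h1
  have i1 := memLp_integrable_norm_sq hU
  have i2 := memLp_integrable_norm_sq hh
  have h2 : ∫ s in a..t, 2 * ⟪h s, U s⟫ ≤ ∫ s in a..t, (ν * ‖U s‖ ^ 2 + ν⁻¹ * ‖h s‖ ^ 2) := by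
    refine integral_mono_Icc ((memLp_integrable_inner hh hU).const_mul 2)
      ((i1.const_mul ν).add (i2.const_mul ν⁻¹)) (ae_of_all _ fun s => ?_) ht
    have h3 := real_inner_le_norm (h s) (U s)
    have h4 : 0 ≤ ν⁻¹ * (ν * ‖U s‖ - ‖h s‖) ^ 2 := by positivity
    have h5 : ν⁻¹ * (ν * ‖U s‖ - ‖h s‖) ^ 2 =
        ν * ‖U s‖ ^ 2 + ν⁻¹ * ‖h s‖ ^ 2 - 2 * (‖h s‖ * ‖U s‖) := by
      field_simp
      ring
    linarith
  rw [intervalIntegral.integral_add ((intervalIntegrable_of_mem_Icc i1 ht).const_mul ν)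
    ((intervalIntegrable_of_mem_Icc i2 ht).const_mul ν⁻¹)] at h2
  simp only [intervalIntegral.integral_const_mul] at h2
  linarith

theorem memLp_clm {F G : Type*} [NormedAddCommGroup F] [NormedSpace ℝ F] [NormedAddCommGroup G]
    [NormedSpace ℝ G] (j : F →L[ℝ] G) {γ : ℝ → F} (hγ : MemLp γ 2 (volume.restrict (Ioc a b))) :
    MemLp (fun s => j (γ s)) 2 (volume.restrict (Ioc a b)) :=
  j.comp_memLp' hγ

variable [CompleteSpace V] [CompleteSpace H]

/-- The right-hand side of the linear problem that is solved by `strongField a α γ`. -/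
noncomputable def strongData (j : V →L[ℝ] H) (ν a : ℝ) (α : V) (γ : ℝ → V) (t : ℝ) : V :=
  j.adjoint (j (γ t)) + ν • strongField a α γ t

theorem memLp_strongData (hab : a ≤ b) (j : V →L[ℝ] H) (ν : ℝ) (α : V) {γ : ℝ → V}
    (hγ : MemLp γ 2 (volume.restrict (Ioc a b))) :
    MemLp (strongData j ν a α γ) 2 (volume.restrict (Ioc a b)) :=
  (memLp_clm (ContinuousLinearMap.adjoint j) (memLp_clm j hγ)).add
    ((memLp_strongField hab α hγ).const_smul ν)

theorem strongData_sub {α α' : V} {γ γ' : ℝ → V} (hγ : MemLp γ 2 (volume.restrict (Ioc a b)))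
    (hγ' : MemLp γ' 2 (volume.restrict (Ioc a b))) {t : ℝ} (ht : t ∈ Icc a b) :
    strongData j ν a (α - α') (γ - γ') t = strongData j ν a α γ t - strongData j ν a α' γ' t := by
  simp only [strongData, strongField_sub hγ hγ' ht, Pi.sub_apply, map_sub, smul_sub]
  abel

theorem inner_strongData (α : V) (γ : ℝ → V) (t : ℝ) (v : V) :
    ⟪strongData j ν a α γ t, v⟫ = ⟪j (γ t), j v⟫ + ν * ⟪strongField a α γ t, v⟫ := by
  simp only [strongData, inner_add_left, ContinuousLinearMap.adjoint_inner_left,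
    real_inner_smul_left]

theorem map_strongField (α : V) {γ : ℝ → V} (hγ : MemLp γ 2 (volume.restrict (Ioc a b)))
    {t : ℝ} (ht : t ∈ Icc a b) :
    j (strongField a α γ t) = j α + ∫ s in a..t, j (γ s) := by
  rw [strongField, map_add, ← j.intervalIntegral_comp_comm
    (intervalIntegrable_of_mem_Icc (integrable_of_memLp_two hγ) ht)]

theorem isLinearSolution_strongField (hab : a ≤ b) (α : V) {γ : ℝ → V}
    (hγ : MemLp γ 2 (volume.restrict (Ioc a b))) :
    IsLinearSolution j ν a b (j α) (strongData j ν a α γ) (fun t => j (strongField a α γ t))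
      (strongField a α γ) where
  continuousOn := j.continuous.comp_continuousOn (continuousOn_strongField hab α hγ)
  memLp := memLp_strongField hab α hγ
  ae_eq := ae_of_all _ fun _ => rfl
  initial := by simp [strongField]
  equation := fun v t ht => by
    have hj := integrable_of_memLp_two (memLp_clm j hγ)
    have hU := integrable_of_memLp_two (memLp_strongField hab α hγ)
    have h1 : ∫ s in a..t, ⟪j (γ s), j v⟫ = ⟪∫ s in a..t, j (γ s), j v⟫ := by
      have hc : (fun r => ⟪j (γ r), j v⟫) = fun r => ⟪j v, j (γ r)⟫ :=
        funext fun r => real_inner_comm _ _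
      rw [hc, real_inner_comm, intervalIntegral.integral_of_le ht.1,
        intervalIntegral.integral_of_le ht.1]
      exact integral_inner (IntegrableOn.mono_set hj (Ioc_subset_Ioc_right ht.2)) _
    simp only [inner_strongData]
    rw [intervalIntegral.integral_add (intervalIntegrable_of_mem_Icc (hj.inner_const _) ht)
      ((intervalIntegrable_of_mem_Icc (hU.inner_const v) ht).const_mul ν),
      intervalIntegral.integral_const_mul, h1, map_strongField α hγ ht, inner_add_left]
    ring

theorem energyEquality_strongField (hab : a ≤ b) (α : V) {γ : ℝ → V}
    (hγ : MemLp γ 2 (volume.restrict (Ioc a b))) :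
    EnergyEquality ν a b (j α) (strongData j ν a α γ) (fun t => j (strongField a α γ t))
      (strongField a α γ) := by
  intro t ht
  have hj := integrable_of_memLp_two (memLp_clm j hγ)
  have hU := memLp_strongField hab α hγ
  have hs : ∀ r ∈ uIcc a t, r ∈ Icc a b := by
    rw [uIcc_of_le ht.1]; exact fun r hr => ⟨hr.1, hr.2.trans ht.2⟩
  have h := inner_integral_eq (intervalIntegrable_of_mem_Icc hj ht)
    (intervalIntegrable_of_mem_Icc hj ht) (j α) (j α)
    (fun r hr => map_strongField (j := j) α hγ (hs r hr))
    (fun r hr => map_strongField (j := j) α hγ (hs r hr))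
  simp only [inner_strongData]
  rw [intervalIntegral.integral_add (intervalIntegrable_of_mem_Icc
      (memLp_integrable_inner (memLp_clm j hγ) (memLp_clm j hU)) ht)
    ((intervalIntegrable_of_mem_Icc (memLp_integrable_inner hU hU) ht).const_mul ν),
    intervalIntegral.integral_const_mul]
  have hc : ∀ r, ⟪j (strongField a α γ r), j (γ r)⟫ = ⟪j (γ r), j (strongField a α γ r)⟫ :=
    fun r => real_inner_comm _ _
  simp only [hc, ← two_mul, intervalIntegral.integral_const_mul,
    real_inner_self_eq_norm_sq] at h ⊢
  linarith

/-- The data of primitives starting from zero form a subspace of L²(V), dense as soon as its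
orthogonal complement is trivial. Both identities used for this, orthogonality and integration by
parts, involve an orthogonal `q` only through `j q` and its primitive. -/
theorem exists_strongData_near (hν : 0 < ν) (hab : a ≤ b) (j : V →L[ℝ] H)
    (h : Lp V 2 (volume.restrict (Ioc a b))) {ε : ℝ} (hε : 0 < ε) :
    ∃ γ : Lp V 2 (volume.restrict (Ioc a b)),
      ‖(memLp_strongData hab j ν 0 (Lp.memLp γ)).toLp (strongData j ν a 0 γ) - h‖ < ε := by
  have cIcc : ∀ᵐ t ∂volume.restrict (Ioc a b), t ∈ Icc a b := by
    filter_upwards [ae_restrict_mem measurableSet_Ioc] with t ht using Ioc_subset_Icc_self ht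
  have sub_ae : ∀ (γ γ' : Lp V 2 (volume.restrict (Ioc a b))), ∀ t ∈ Icc a b, ∫ s in a..t, (γ + γ') s =
      (∫ s in a..t, γ s) + ∫ s in a..t, γ' s := by
    intro γ γ' t ht
    rw [← intervalIntegral.integral_add
      (intervalIntegrable_of_mem_Icc (integrable_of_memLp_two (Lp.memLp γ)) ht)
      (intervalIntegrable_of_mem_Icc (integrable_of_memLp_two (Lp.memLp γ')) ht),
      intervalIntegral.integral_of_le ht.1, intervalIntegral.integral_of_le ht.1]
    refine integral_congr_ae (ae_restrict_of_ae_restrict_of_subset (Ioc_subset_Ioc_right ht.2) ?_)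
    exact Lp.coeFn_add γ γ'
  have smul_ae : ∀ (c : ℝ) (γ : Lp V 2 (volume.restrict (Ioc a b))), ∀ t ∈ Icc a b, ∫ s in a..t, (c • γ) s =
      c • ∫ s in a..t, γ s := by
    intro c γ t ht
    rw [← intervalIntegral.integral_smul,
      intervalIntegral.integral_of_le ht.1, intervalIntegral.integral_of_le ht.1]
    refine integral_congr_ae (ae_restrict_of_ae_restrict_of_subset (Ioc_subset_Ioc_right ht.2) ?_)
    exact Lp.coeFn_smul c γ
  let D : Lp V 2 (volume.restrict (Ioc a b)) →ₗ[ℝ] Lp V 2 (volume.restrict (Ioc a b)) :=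
    { toFun := fun γ => (memLp_strongData hab j ν 0 (Lp.memLp γ)).toLp (strongData j ν a 0 γ)
      map_add' := fun γ γ' => by
        rw [← MemLp.toLp_add]
        refine MemLp.toLp_congr _ _ ?_
        filter_upwards [cIcc, Lp.coeFn_add γ γ'] with t ht h1
        simp only [strongData, strongField, Pi.add_apply, h1, sub_ae γ γ' t ht, map_add, smul_add]
        simp only [smul_zero]
        abel
      map_smul' := fun c γ => by
        rw [RingHom.id_apply, ← MemLp.toLp_const_smul]
        refine MemLp.toLp_congr _ _ ?_
        filter_upwards [cIcc, Lp.coeFn_smul c γ] with t ht h1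
        simp only [strongData, strongField, Pi.smul_apply, h1, smul_ae c γ t ht, map_smul,
          smul_add, zero_add, smul_comm ν c] }
  have hD : (LinearMap.range D).topologicalClosure = ⊤ := by
    rw [Submodule.topologicalClosure_eq_top_iff, Submodule.eq_bot_iff]
    intro q hq
    rw [Submodule.mem_orthogonal] at hq
    have hq' : ∀ γ : Lp V 2 (volume.restrict (Ioc a b)), (∫ s in a..b, ⟪j (γ s), j (q s)⟫)
        + ν * ∫ s in a..b, ⟪strongField a 0 γ s, q s⟫ = 0 := by
      intro γ
      have h0 := hq (D γ) ⟨γ, rfl⟩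
      rw [L2.inner_def] at h0
      have hb := right_mem_Icc.2 hab
      rw [← intervalIntegral.integral_const_mul, ← intervalIntegral.integral_add
        (intervalIntegrable_of_mem_Icc (memLp_integrable_inner (memLp_clm j (Lp.memLp γ))
          (memLp_clm j (Lp.memLp q))) hb)
        ((intervalIntegrable_of_mem_Icc (memLp_integrable_inner
          (memLp_strongField hab 0 (Lp.memLp γ)) (Lp.memLp q)) hb).const_mul ν),
        intervalIntegral.integral_of_le hab, ← h0]
      refine integral_congr_ae ?_
      filter_upwards [(memLp_strongData hab j ν 0 (Lp.memLp γ)).coeFn_toLp] with s hs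
      simp only [D, LinearMap.coe_mk, AddHom.coe_mk, hs, inner_strongData]
    have hb := right_mem_Icc.2 hab
    have parts : ∀ γ : Lp V 2 (volume.restrict (Ioc a b)), (∫ s in a..b, ⟪γ s, strongField a 0 q s⟫) +
        (∫ s in a..b, ⟪strongField a 0 γ s, q s⟫) =
        ⟪strongField a 0 γ b, strongField a 0 q b⟫ := by
      intro γ
      have h1 := inner_integral_eq
        (intervalIntegrable_of_mem_Icc (integrable_of_memLp_two (Lp.memLp γ)) hb)
        (intervalIntegrable_of_mem_Icc (integrable_of_memLp_two (Lp.memLp q)) hb) 0 0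
        (F := strongField a 0 γ) (G := strongField a 0 q) (fun _ _ => rfl) (fun _ _ => rfl)
      rw [h1, inner_zero_left, zero_add, intervalIntegral.integral_add
        (intervalIntegrable_of_mem_Icc (memLp_integrable_inner (Lp.memLp γ)
          (memLp_strongField hab 0 (Lp.memLp q))) hb)
        (intervalIntegrable_of_mem_Icc (memLp_integrable_inner
          (memLp_strongField hab 0 (Lp.memLp γ)) (Lp.memLp q)) hb)]
    have hsymm : (∫ s in a..b, ⟪q s, strongField a 0 q s⟫) =
        ∫ s in a..b, ⟪strongField a 0 q s, q s⟫ :=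
      intervalIntegral.integral_congr fun s _ => real_inner_comm _ _
    -- Choosing `γ = q` makes orthogonality read `∫ ‖j q‖² + ν/2 ‖Q b‖² = 0`, with `Q` the primitive
    -- of `q`; hence both terms vanish.
    have e1 := hq' q
    have e2 := parts q
    rw [hsymm, real_inner_self_eq_norm_sq] at e2
    have hjq0 : 0 ≤ ∫ s in a..b, ⟪j (q s), j (q s)⟫ :=
      intervalIntegral.integral_nonneg hab fun _ _ => real_inner_self_nonneg
    have hQ0 : 0 ≤ ν * ∫ s in a..b, ⟪strongField a 0 q s, q s⟫ :=
      mul_nonneg hν.le (by nlinarith [sq_nonneg ‖strongField a 0 q b‖])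
    have hjq : ∫ s in a..b, ⟪j (q s), j (q s)⟫ = 0 := by linarith
    have hQb : strongField a 0 (q : ℝ → V) b = 0 := by
      have h1 : ν * ∫ s in a..b, ⟪strongField a 0 q s, q s⟫ = 0 := by linarith
      have h2 := (mul_eq_zero.1 h1).resolve_left hν.ne'
      rw [h2] at e2
      exact norm_eq_zero.1 ((pow_eq_zero_iff two_ne_zero).1 (by linarith))
    have hjq' : ∀ᵐ s ∂volume.restrict (Ioc a b), j (q s) = 0 := by
      rw [intervalIntegral.integral_of_le hab, integral_eq_zero_iff_of_nonneg
        (fun _ => real_inner_self_nonneg) (memLp_integrable_inner (memLp_clm j (Lp.memLp q))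
          (memLp_clm j (Lp.memLp q)))] at hjq
      filter_upwards [hjq] with s hs using inner_self_eq_zero.1 hs
    -- Since `j q = 0` and `Q b = 0`, orthogonality and integration by parts reduce to `∫ ⟪γ, Q⟫ =
    -- 0`. The choice `γ = Q` then gives `Q = 0`, hence `q = 0`.
    have hort : ∀ γ : Lp V 2 (volume.restrict (Ioc a b)), (∫ s in a..b, ⟪γ s, strongField a 0 q s⟫) = 0 := by
      intro γ
      have h1 := hq' γ
      have h2 := parts γ
      have h3 : ∫ s in a..b, ⟪j (γ s), j (q s)⟫ = ∫ s in a..b, (0 : ℝ) :=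
        integral_congr_Icc (hjq'.mono fun s hs => by simp only [hs, inner_zero_right]) hb
      rw [h3, intervalIntegral.integral_zero, zero_add] at h1
      rw [(mul_eq_zero.1 h1).resolve_left hν.ne', hQb, inner_zero_right, add_zero] at h2
      exact h2
    have hP := memLp_strongField hab 0 (Lp.memLp q)
    have hz : ∀ᵐ s ∂volume.restrict (Ioc a b), strongField a 0 (q : ℝ → V) s = 0 := by
      have h1 := hort (hP.toLp _)
      rw [integral_congr_Icc (ψ := fun s => ⟪strongField a 0 (q : ℝ → V) s, strongField a 0 q s⟫)
        (hP.coeFn_toLp.mono fun s hs => by simp only [hs]) hb,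
        intervalIntegral.integral_of_le hab, integral_eq_zero_iff_of_nonneg
        (fun _ => real_inner_self_nonneg) (memLp_integrable_inner hP hP)] at h1
      filter_upwards [h1] with s hs using inner_self_eq_zero.1 hs
    have hz' : ∀ t ∈ Icc a b, ∫ s in a..t, q s = 0 := by
      rcases eq_or_lt_of_le hab with rfl | hlt
      · intro t ht
        rw [le_antisymm ht.2 ht.1, intervalIntegral.integral_same]
      · have := Measure.eqOn_Icc_of_ae_eq volume hlt.ne (f := strongField a 0 (q : ℝ → V))
          (g := fun _ => 0) (by rwa [← Measure.restrict_congr_set Ioc_ae_eq_Icc])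
          (continuousOn_strongField hab 0 (Lp.memLp q)) continuousOn_const
        intro t ht
        simpa [strongField] using this ht
    have hq0 := ae_eq_zero_of_integral_eq_zero hab
      (intervalIntegrable_of_mem_Icc (integrable_of_memLp_two (Lp.memLp q)) hb) hz'
    exact Lp.eq_zero_iff_ae_eq_zero.2 hq0
  have hmem : h ∈ (LinearMap.range D).topologicalClosure := by rw [hD]; trivial
  obtain ⟨y, ⟨γ, rfl⟩, hy⟩ := Metric.mem_closure_iff.1 hmem ε hε
  refine ⟨γ, ?_⟩
  rw [dist_comm, dist_eq_norm] at hy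
  exact hy

end LinearExistence

/-! ### Solvability and energy equality for general data. -/

section LinearSolution

theorem cauchySeq_of_sq_le {X : Type*} [PseudoMetricSpace X] {x : ℕ → X} {e : ℕ × ℕ → ℝ}
    (he : Tendsto e atTop (𝓝 0)) (h : ∀ p : ℕ × ℕ, dist (x p.1) (x p.2) ^ 2 ≤ e p) :
    CauchySeq x := by
  rw [cauchySeq_iff_tendsto_dist_atTop_0]
  have h1 : Tendsto (fun p => √(e p)) atTop (𝓝 0) := by
    simpa [Function.comp_def] using (Real.continuous_sqrt.tendsto 0).comp he
  exact squeeze_zero (fun _ => dist_nonneg) (fun p => Real.le_sqrt_of_sq_le (h p)) h1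

variable {V H : Type*} [NormedAddCommGroup V] [InnerProductSpace ℝ V] [CompleteSpace V]
  [NormedAddCommGroup H] [InnerProductSpace ℝ H] [CompleteSpace H] {j : V →L[ℝ] H} {ν a b : ℝ}

/-- Approximate the initial value by `j (α n)` and the data by data of explicit solutions. The
energy estimate for differences makes these Cauchy uniformly in `H` and in L²(V), and both the
equation and the energy equality survive the limit. -/
theorem exists_linearSolution (hν : 0 < ν) (hab : a ≤ b) {u₀ : H}
    (hu₀ : u₀ ∈ closure (Set.range j)) {h : ℝ → V} (hh : MemLp h 2 (volume.restrict (Ioc a b))) :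
    ∃ u U, IsLinearSolution j ν a b u₀ h u U ∧ EnergyEquality ν a b u₀ h u U := by
  obtain ⟨x, hx, hx₀⟩ := mem_closure_iff_seq_limit.1 hu₀
  choose α hα using hx
  have hcm : ∀ n, MemLp (fun _ : ℝ => ν • α n) 2 (volume.restrict (Ioc a b)) :=
    fun n => memLp_const _
  -- A nonzero starting point `α n` adds exactly the constant `ν • α n` to the data, so that
  -- constant is subtracted from the target beforehand.
  choose γ hγ using fun n : ℕ => exists_strongData_near hν hab j
    (hh.toLp h - (hcm n).toLp _) (Nat.one_div_pos_of_nat (n := n) (α := ℝ))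
  have cIcc : ∀ᵐ t ∂volume.restrict (Ioc a b), t ∈ Icc a b := by
    filter_upwards [ae_restrict_mem measurableSet_Ioc] with t ht using Ioc_subset_Icc_self ht
  have mU : ∀ n, MemLp (strongField a (α n) (γ n)) 2 (volume.restrict (Ioc a b)) :=
    fun n => memLp_strongField hab _ (Lp.memLp _)
  have mh : ∀ n, MemLp (strongData j ν a (α n) (γ n)) 2 (volume.restrict (Ioc a b)) :=
    fun n => memLp_strongData hab j ν _ (Lp.memLp _)
  set UL : ℕ → Lp V 2 (volume.restrict (Ioc a b)) := fun n => (mU n).toLp _ with hUL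
  set HL : ℕ → Lp V 2 (volume.restrict (Ioc a b)) := fun n => (mh n).toLp _ with hHL
  have tα : Tendsto (fun n => j (α n)) atTop (𝓝 u₀) := by simpa only [hα] using hx₀
  have tH : Tendsto HL atTop (𝓝 (hh.toLp h)) := by
    rw [tendsto_iff_norm_sub_tendsto_zero]
    refine squeeze_zero (fun _ => norm_nonneg _) (fun n => ?_) tendsto_one_div_add_atTop_nhds_zero_nat
    refine le_trans (le_of_eq ?_) (hγ n).le
    congr 1
    have : HL n = (memLp_strongData hab j ν 0 (Lp.memLp (γ n))).toLp (strongData j ν a 0 (γ n))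
        + (hcm n).toLp _ := by
      rw [hHL, ← MemLp.toLp_add]
      refine MemLp.toLp_congr _ _ (ae_of_all _ fun t => ?_)
      simp only [strongData, strongField, Pi.add_apply, smul_add, smul_zero]
      abel
    rw [this]
    abel
  set e : ℕ × ℕ → ℝ := fun p => dist (j (α p.1)) (j (α p.2)) ^ 2
    + ν⁻¹ * dist (HL p.1) (HL p.2) ^ 2 with he_def
  have he : Tendsto e atTop (𝓝 0) := by
    have h1 := cauchySeq_iff_tendsto_dist_atTop_0.1 tα.cauchySeq
    have h2 := cauchySeq_iff_tendsto_dist_atTop_0.1 tH.cauchySeq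
    simpa using (h1.pow 2).add ((h2.pow 2).const_mul ν⁻¹)
  have est : ∀ p : ℕ × ℕ, ∀ t ∈ Icc a b,
      dist (j (strongField a (α p.1) (γ p.1) t)) (j (strongField a (α p.2) (γ p.2) t)) ^ 2
      + ν * ∫ s in a..t, ‖strongField a (α p.1) (γ p.1) s - strongField a (α p.2) (γ p.2) s‖ ^ 2
        ≤ e p := by
    rintro ⟨n, m⟩ t ht
    have mγ : MemLp ((γ n : ℝ → V) - (γ m : ℝ → V)) 2 (volume.restrict (Ioc a b)) :=
      (Lp.memLp _).sub (Lp.memLp _)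
    have h1 := (energyEquality_strongField (j := j) (ν := ν) hab (α n - α m) mγ).estimate hν
      (memLp_strongData hab j ν _ mγ) (memLp_strongField hab _ mγ) ht
    simp only
    rw [integral_congr_Icc (cIcc.mono fun s hs => by
      rw [strongField_sub (Lp.memLp _) (Lp.memLp _) hs]) ht,
      strongField_sub (Lp.memLp _) (Lp.memLp _) ht, map_sub, map_sub] at h1
    rw [dist_eq_norm]
    refine h1.trans ?_
    simp only [he_def, dist_eq_norm]
    refine add_le_add le_rfl (mul_le_mul_of_nonneg_left ?_ (inv_nonneg.2 hν.le))
    refine (integral_le_of_mem_Icc (memLp_integrable_norm_sq (memLp_strongData hab j ν _ mγ))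
      (fun _ => sq_nonneg _) ht).trans (le_of_eq ?_)
    rw [hHL, ← MemLp.toLp_sub, toLp_norm_sq]
    refine integral_congr_ae (cIcc.mono fun s hs => ?_)
    simp only [strongData_sub (Lp.memLp _) (Lp.memLp _) hs, Pi.sub_apply]
  have hint0 : ∀ (p : ℕ × ℕ) (t : ℝ), t ∈ Icc a b → 0 ≤ ν * ∫ s in a..t,
      ‖strongField a (α p.1) (γ p.1) s - strongField a (α p.2) (γ p.2) s‖ ^ 2 := fun p t ht =>
    mul_nonneg hν.le (intervalIntegral.integral_nonneg ht.1 fun _ _ => sq_nonneg _)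
  have est1 : ∀ p : ℕ × ℕ, ∀ t ∈ Icc a b,
      dist (j (strongField a (α p.1) (γ p.1) t)) (j (strongField a (α p.2) (γ p.2) t)) ^ 2 ≤ e p :=
    fun p t ht => by linarith [est p t ht, hint0 p t ht]
  have hb := right_mem_Icc.2 hab
  have est2 : ∀ p : ℕ × ℕ, dist (UL p.1) (UL p.2) ^ 2 ≤ ν⁻¹ * e p := by
    intro p
    have h1 := est p b hb
    have h2 : dist (UL p.1) (UL p.2) ^ 2 = ∫ s in a..b,
        ‖strongField a (α p.1) (γ p.1) s - strongField a (α p.2) (γ p.2) s‖ ^ 2 := by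
      rw [dist_eq_norm, hUL, ← MemLp.toLp_sub, toLp_norm_sq, intervalIntegral.integral_of_le hab]
      rfl
    rw [← h2] at h1
    rw [← div_eq_inv_mul, le_div_iff₀ hν]
    linarith [sq_nonneg (dist (j (strongField a (α p.1) (γ p.1) b))
      (j (strongField a (α p.2) (γ p.2) b)))]
  have cU : CauchySeq UL :=
    cauchySeq_of_sq_le (e := fun p => ν⁻¹ * e p) (by simpa using he.const_mul ν⁻¹) est2
  obtain ⟨U, tU⟩ := cauchySeq_tendsto_of_complete cU
  have cu : ∀ t ∈ Icc a b, ∃ y, Tendsto (fun n => j (strongField a (α n) (γ n) t)) atTop (𝓝 y) :=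
    fun t ht => cauchySeq_tendsto_of_complete (cauchySeq_of_sq_le he fun p => est1 p t ht)
  choose! u tu using cu
  have hunif : TendstoUniformlyOn (fun n t => j (strongField a (α n) (γ n) t)) u atTop
      (Icc a b) := by
    refine UniformCauchySeqOn.tendstoUniformlyOn_of_tendsto ?_ tu
    intro W hW
    obtain ⟨ε, hε, hεW⟩ := Metric.mem_uniformity_dist.1 hW
    rw [prod_atTop_atTop_eq]
    filter_upwards [he.eventually_lt_const (sq_pos_of_pos hε)] with p hp t ht
    exact hεW (lt_of_pow_lt_pow_left₀ 2 hε.le ((est1 p t ht).trans_lt hp))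
  have coeUL : ∀ n, UL n =ᵐ[volume.restrict (Ioc a b)] strongField a (α n) (γ n) :=
    fun n => (mU n).coeFn_toLp
  have coeHL : ∀ n, HL n =ᵐ[volume.restrict (Ioc a b)] strongData j ν a (α n) (γ n) :=
    fun n => (mh n).coeFn_toLp
  have tUU : ∀ t ∈ Icc a b, Tendsto (fun n => ∫ s in a..t,
      ⟪strongField a (α n) (γ n) s, strongField a (α n) (γ n) s⟫) atTop
      (𝓝 (∫ s in a..t, ⟪U s, U s⟫)) := by
    intro t ht
    refine (tendsto_integral_inner tU tU ht).congr fun n => integral_congr_Icc ?_ ht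
    filter_upwards [coeUL n] with s hs using by rw [hs]
  have tHU : ∀ t ∈ Icc a b, Tendsto (fun n => ∫ s in a..t,
      ⟪strongData j ν a (α n) (γ n) s, strongField a (α n) (γ n) s⟫) atTop
      (𝓝 (∫ s in a..t, ⟪h s, U s⟫)) := by
    intro t ht
    have h1 := tendsto_integral_inner tH tU ht
    rw [integral_congr_Icc (ψ := fun s => ⟪h s, U s⟫)
      (hh.coeFn_toLp.mono fun s hs => by simp only [hs]) ht] at h1
    refine h1.congr fun n => integral_congr_Icc ?_ ht
    filter_upwards [coeUL n, coeHL n] with s hs hs' using by rw [hs, hs']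
  refine ⟨u, U, ⟨?_, Lp.memLp U, ?_, ?_, fun v t ht => ?_⟩, fun t ht => ?_⟩
  · exact hunif.continuousOn (Eventually.frequently (Eventually.of_forall fun n =>
      j.continuous.comp_continuousOn (continuousOn_strongField hab _ (Lp.memLp _))))
  -- The L² limit is identified with the pointwise limit in `H` along a subsequence converging
  -- almost everywhere.
  · obtain ⟨ns, hns, hae⟩ := (tendstoInMeasure_of_tendsto_Lp tU).exists_seq_tendsto_ae
    filter_upwards [hae, cIcc, ae_all_iff.2 coeUL] with t h1 h2 h3
    have h4 := (j.continuous.tendsto _).comp h1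
    refine tendsto_nhds_unique ((tu t h2).comp hns.tendsto_atTop) (h4.congr fun n => ?_)
    simp only [Function.comp, h3]
  · refine tendsto_nhds_unique (tu a (left_mem_Icc.2 hab)) (tα.congr fun n => ?_)
    simp [strongField]
  · have cv : MemLp (fun _ : ℝ => v) 2 (volume.restrict (Ioc a b)) := memLp_const _
    have k : ∀ F : ℝ → V, ∀ F' : ℝ → V, F =ᵐ[volume.restrict (Ioc a b)] F' →
        ∫ s in a..t, ⟪F s, cv.toLp _ s⟫ = ∫ s in a..t, ⟪F' s, v⟫ := fun F F' hF =>
      integral_congr_Icc (by filter_upwards [hF, cv.coeFn_toLp] with s h1 h2; rw [h1, h2]) ht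
    have t1 := tendsto_integral_inner tU (tendsto_const_nhds (x := cv.toLp _)) ht
    have t2 := tendsto_integral_inner tH (tendsto_const_nhds (x := cv.toLp _)) ht
    rw [k _ _ Filter.EventuallyEq.rfl] at t1
    rw [k _ _ hh.coeFn_toLp] at t2
    refine tendsto_nhds_unique (((tu t ht).inner tendsto_const_nhds).add (t1.const_mul ν))
      (((tα.inner tendsto_const_nhds).add t2).congr fun n => ?_)
    rw [k _ _ (coeUL n), k _ _ (coeHL n)]
    exact ((isLinearSolution_strongField (j := j) (ν := ν) hab (α n)
      (Lp.memLp (γ n))).equation v t ht).symm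
  · refine tendsto_nhds_unique (((tu t ht).norm.pow 2).add ((tUU t ht).const_mul (2 * ν)))
      (((tα.norm.pow 2).add ((tHU t ht).const_mul 2)).congr fun n => ?_)
    exact (energyEquality_strongField (j := j) (ν := ν) hab (α n) (Lp.memLp (γ n)) t ht).symm

/-- The constructed solution has the energy equality, and uniqueness identifies any other solution
with it. -/
theorem IsLinearSolution.energyEquality {u₀ : H} {h : ℝ → V} {u : ℝ → H} {U : ℝ → V} (hν : 0 < ν)
    (hab : a ≤ b) (s : IsLinearSolution j ν a b u₀ h u U) (hu₀ : u₀ ∈ closure (Set.range j))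
    (hh : MemLp h 2 (volume.restrict (Ioc a b))) : EnergyEquality ν a b u₀ h u U := by
  obtain ⟨u', U', s', e⟩ := exists_linearSolution hν hab hu₀ hh
  obtain ⟨h1, h2⟩ := s.unique hν hab s' hh
  intro t ht
  rw [h1 t ht, integral_congr_Icc (φ := fun s => ⟪U s, U s⟫) (ψ := fun s => ⟪U' s, U' s⟫)
    (h2.mono fun s hs => by simp only [hs]) ht,
    integral_congr_Icc (φ := fun s => ⟪h s, U s⟫) (ψ := fun s => ⟪h s, U' s⟫)
    (h2.mono fun s hs => by simp only [hs]) ht]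
  exact e t ht

theorem IsLinearSolution.estimate_sub {u₀ : H} {h h' : ℝ → V} {u u' : ℝ → H} {U U' : ℝ → V}
    (hν : 0 < ν) (hab : a ≤ b) (s : IsLinearSolution j ν a b u₀ h u U)
    (s' : IsLinearSolution j ν a b u₀ h' u' U') (hh : MemLp h 2 (volume.restrict (Ioc a b)))
    (hh' : MemLp h' 2 (volume.restrict (Ioc a b))) {t : ℝ} (ht : t ∈ Icc a b) :
    ‖u t - u' t‖ ^ 2 + ν * ∫ r in a..t, ‖U r - U' r‖ ^ 2 ≤
      ν⁻¹ * ∫ r in a..t, ‖h r - h' r‖ ^ 2 := by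
  have h1 := s.sub s' hh hh'
  rw [sub_self] at h1
  have h0 : (0 : H) ∈ closure (Set.range j) := subset_closure ⟨0, map_zero j⟩
  have h2 := (h1.energyEquality hν hab h0 (hh.sub hh')).estimate hν (hh.sub hh') h1.memLp ht
  simpa using h2

end LinearSolution

/-! ### Lower-order perturbations: contraction, uniqueness, global existence. -/

section Semilinear

variable {V H : Type*} [NormedAddCommGroup V] [InnerProductSpace ℝ V]
  [NormedAddCommGroup H] [InnerProductSpace ℝ H] {j : V →L[ℝ] H} {ν a b : ℝ}

/-- `G 0` may be nonzero, but constants are square integrable on a bounded interval. -/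
theorem memLp_lipschitz_comp {E F : Type*} [NormedAddCommGroup E] [NormedAddCommGroup F]
    {G : E → F} {K : NNReal} (hK : LipschitzWith K G) {U : ℝ → E}
    (hU : MemLp U 2 (volume.restrict (Ioc a b))) :
    MemLp (fun t => G (U t)) 2 (volume.restrict (Ioc a b)) := by
  have h0 : LipschitzWith K fun x => G x - G 0 :=
    LipschitzWith.of_dist_le_mul fun x y => by
      rw [dist_sub_right]; exact hK.dist_le_mul x y
  have h1 : MemLp ((fun x => G x - G 0) ∘ U) 2 (volume.restrict (Ioc a b)) :=
    h0.comp_memLp (by simp) hU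
  refine (h1.add (memLp_const (μ := volume.restrict (Ioc a b)) (G 0))).ae_eq
    (ae_of_all _ fun t => ?_)
  simp

theorem IsLinearSolution.congr {u₀ : H} {h h' : ℝ → V} {u u' : ℝ → H} {U U' : ℝ → V}
    (s : IsLinearSolution j ν a b u₀ h u U) (hab : a ≤ b)
    (hh : h =ᵐ[volume.restrict (Ioc a b)] h')
    (hu : ∀ t ∈ Icc a b, u t = u' t) (hU : U =ᵐ[volume.restrict (Ioc a b)] U') :
    IsLinearSolution j ν a b u₀ h' u' U' where
  continuousOn := s.continuousOn.congr fun t ht => (hu t ht).symm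
  memLp := s.memLp.ae_eq hU
  ae_eq := by
    filter_upwards [s.ae_eq, hU, ae_restrict_mem measurableSet_Ioc] with t h1 h2 h3
    rw [← hu t (Ioc_subset_Icc_self h3), h1, h2]
  initial := by rw [← hu a (left_mem_Icc.2 hab), s.initial]
  equation := fun v t ht => by
    rw [← hu t ht, ← integral_congr_Icc (φ := fun s => ⟪U s, v⟫) (ψ := fun s => ⟪U' s, v⟫)
      (hU.mono fun s hs => by simp only [hs]) ht,
      ← integral_congr_Icc (φ := fun s => ⟪h s, v⟫) (ψ := fun s => ⟪h' s, v⟫)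
      (hh.mono fun s hs => by simp only [hs]) ht]
    exact s.equation v t ht

theorem IsLinearSolution.restrict {u₀ : H} {h : ℝ → V} {u : ℝ → H} {U : ℝ → V} {c : ℝ}
    (s : IsLinearSolution j ν a b u₀ h u U) (hcb : c ≤ b) :
    IsLinearSolution j ν a c u₀ h u U where
  continuousOn := s.continuousOn.mono (Icc_subset_Icc_right hcb)
  memLp := s.memLp.mono_measure (Measure.restrict_mono (Ioc_subset_Ioc_right hcb) le_rfl)
  ae_eq := ae_restrict_of_ae_restrict_of_subset (Ioc_subset_Ioc_right hcb) s.ae_eq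
  initial := s.initial
  equation := fun v t ht => s.equation v t (Icc_subset_Icc_right hcb ht)

/-- A quantitative form of `G` being Lipschitz from an intermediate space of `V ⊂ H` to `V*`. -/
def IsLowerOrder (j : V →L[ℝ] H) (G : V → V) : Prop :=
  ∀ ε > 0, ∃ C ≥ 0, ∀ u v, ‖G u - G v‖ ^ 2 ≤ ε * ‖u - v‖ ^ 2 + C * ‖j u - j v‖ ^ 2

theorem IsLowerOrder.lipschitz {G : V → V} (hG : IsLowerOrder j G) : ∃ K, LipschitzWith K G := by
  obtain ⟨C, hC, h⟩ := hG 1 one_pos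
  refine ⟨_, LipschitzWith.of_dist_le_mul (K := (√(1 + C * ‖j‖ ^ 2)).toNNReal)
    fun u v => ?_⟩
  rw [dist_eq_norm, dist_eq_norm, Real.coe_toNNReal _ (Real.sqrt_nonneg _)]
  refine abs_le_of_sq_le_sq' ?_ (by positivity) |>.2
  rw [mul_pow, Real.sq_sqrt (by positivity)]
  have h1 : ‖j u - j v‖ ^ 2 ≤ ‖j‖ ^ 2 * ‖u - v‖ ^ 2 := by
    rw [← map_sub, ← mul_pow]
    gcongr
    exact j.le_opNorm _
  nlinarith [h u v, mul_le_mul_of_nonneg_left h1 hC]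

variable [CompleteSpace V] [CompleteSpace H]

/-- The solution map of the linear problem with right-hand side `g - G(W)` halves an exponentially
weighted energy norm. -/
theorem IsLowerOrder.exists_contraction {G : V → V} (hG : IsLowerOrder j G) (hν : 0 < ν) :
    ∃ κ > 0, ∀ {a b : ℝ} {u₀ : H} {g : ℝ → V} {u₁ u₂ w₁ w₂ : ℝ → H} {U₁ U₂ W₁ W₂ : ℝ → V} {M : ℝ},
      a ≤ b → MemLp g 2 (volume.restrict (Ioc a b)) →
      MemLp W₁ 2 (volume.restrict (Ioc a b)) → MemLp W₂ 2 (volume.restrict (Ioc a b)) →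
      (∀ᵐ t ∂volume.restrict (Ioc a b), w₁ t = j (W₁ t)) →
      (∀ᵐ t ∂volume.restrict (Ioc a b), w₂ t = j (W₂ t)) →
      IsLinearSolution j ν a b u₀ (fun t => g t - G (W₁ t)) u₁ U₁ →
      IsLinearSolution j ν a b u₀ (fun t => g t - G (W₂ t)) u₂ U₂ →
      (∀ t ∈ Icc a b, ‖w₁ t - w₂ t‖ ^ 2 + ν * ∫ s in a..t, ‖W₁ s - W₂ s‖ ^ 2 ≤
        M * Real.exp (κ * (t - a))) →
      ∀ t ∈ Icc a b, ‖u₁ t - u₂ t‖ ^ 2 + ν * ∫ s in a..t, ‖U₁ s - U₂ s‖ ^ 2 ≤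
        M / 2 * Real.exp (κ * (t - a)) := by
  -- After the factor `ν⁻¹` of the energy estimate, `ν²/4` turns into a quarter of `ν ∫ ‖W₁ - W₂‖²`.
  obtain ⟨C, hC, h⟩ := hG (ν ^ 2 / 4) (by positivity)
  obtain ⟨K, hK⟩ := hG.lipschitz
  -- This `κ` gives `C/κ ≤ ν/4`, so the lower-order term costs another quarter; the summand `1`
  -- keeps `κ` positive when `C = 0`.
  refine ⟨4 * C / ν + 1, by positivity, ?_⟩
  set κ := 4 * C / ν + 1 with hκ_def
  have hκ : 0 < κ := by positivity
  intro a b u₀ g u₁ u₂ w₁ w₂ U₁ U₂ W₁ W₂ M hab hg hW₁ hW₂ hw₁ hw₂ s₁ s₂ hM t ht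
  have mG₁ := memLp_lipschitz_comp hK hW₁
  have mG₂ := memLp_lipschitz_comp hK hW₂
  have h1 := s₁.estimate_sub hν hab s₂ (hg.sub mG₁) (hg.sub mG₂) ht
  refine h1.trans ?_
  have hW : Integrable (fun s => ‖W₁ s - W₂ s‖ ^ 2) (volume.restrict (Ioc a b)) :=
    memLp_integrable_norm_sq (hW₁.sub hW₂)
  have hexp : Integrable (fun s => M * Real.exp (κ * (s - a))) (volume.restrict (Ioc a b)) :=
    (Continuous.integrableOn_Ioc (by fun_prop))
  have h2 : ∫ r in a..t, ‖g r - G (W₁ r) - (g r - G (W₂ r))‖ ^ 2 ≤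
      ∫ r in a..t, (ν ^ 2 / 4 * ‖W₁ r - W₂ r‖ ^ 2 + C * (M * Real.exp (κ * (r - a)))) := by
    refine integral_mono_Icc (memLp_integrable_norm_sq ((hg.sub mG₁).sub (hg.sub mG₂)))
      ((hW.const_mul _).add (hexp.const_mul _)) ?_ ht
    filter_upwards [hw₁, hw₂, ae_restrict_mem measurableSet_Ioc] with r e1 e2 hr
    have h3 := h (W₁ r) (W₂ r)
    have h4 := hM r (Ioc_subset_Icc_self hr)
    have h5 : 0 ≤ ν * ∫ s in a..r, ‖W₁ s - W₂ s‖ ^ 2 :=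
      mul_nonneg hν.le (intervalIntegral.integral_nonneg hr.1.le fun _ _ => sq_nonneg _)
    rw [sub_sub_sub_cancel_left, norm_sub_rev]
    refine h3.trans (add_le_add le_rfl (mul_le_mul_of_nonneg_left ?_ hC))
    rw [← e1, ← e2]
    linarith
  rw [intervalIntegral.integral_add ((intervalIntegrable_of_mem_Icc hW ht).const_mul _)
    ((intervalIntegrable_of_mem_Icc hexp ht).const_mul _)] at h2
  simp only [intervalIntegral.integral_const_mul] at h2
  have hM0 : 0 ≤ M := by
    have := hM a (left_mem_Icc.2 hab)
    simp only [intervalIntegral.integral_same, mul_zero, add_zero, sub_self, Real.exp_zero,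
      mul_one] at this
    exact (sq_nonneg _).trans this
  have he : ∫ r in a..t, Real.exp (κ * (r - a)) = κ⁻¹ * (Real.exp (κ * (t - a)) - 1) := by
    have hd : ∀ x ∈ uIcc a t, HasDerivAt (fun r => κ⁻¹ * Real.exp (κ * (r - a)))
        (Real.exp (κ * (x - a))) x := by
      intro x _
      have := (((hasDerivAt_id x).sub_const a).const_mul κ).exp.const_mul κ⁻¹
      refine this.congr_deriv ?_
      simp only [id]
      field_simp
    rw [intervalIntegral.integral_eq_sub_of_hasDerivAt hd
      (Continuous.intervalIntegrable (by fun_prop) _ _)]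
    simp only [sub_self, mul_zero, Real.exp_zero]
    ring
  rw [he] at h2
  have h6 := hM t ht
  have hwt : 0 ≤ ‖w₁ t - w₂ t‖ ^ 2 := sq_nonneg _
  have hCκ : C * κ⁻¹ ≤ ν / 4 := by
    rw [← div_eq_mul_inv, div_le_div_iff₀ hκ (by norm_num), hκ_def]
    field_simp
    nlinarith
  set E := Real.exp (κ * (t - a))
  have hE : 1 ≤ E := Real.one_le_exp (mul_nonneg hκ.le (by linarith [ht.1]))
  have h7 : C * (M * (κ⁻¹ * (E - 1))) ≤ ν / 4 * (M * E) := by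
    calc C * (M * (κ⁻¹ * (E - 1))) = (C * κ⁻¹) * (M * (E - 1)) := by ring
      _ ≤ ν / 4 * (M * (E - 1)) :=
        mul_le_mul_of_nonneg_right hCκ (mul_nonneg hM0 (by linarith))
      _ ≤ ν / 4 * (M * E) := by gcongr; linarith
  rw [inv_mul_le_iff₀ hν]
  nlinarith

/-- Each solution is its own image under the solution map. The linear estimate gives some initial
bound `M` for the weighted distance, and the contraction improves it to `M / 2 ^ n` for every `n`.
-/
theorem IsLinearSolution.semilinear_unique {G : V → V} (hG : IsLowerOrder j G) (hν : 0 < ν)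
    (hab : a ≤ b) {u₀ : H} {g : ℝ → V} {u₁ u₂ : ℝ → H} {U₁ U₂ : ℝ → V}
    (hg : MemLp g 2 (volume.restrict (Ioc a b)))
    (s₁ : IsLinearSolution j ν a b u₀ (fun t => g t - G (U₁ t)) u₁ U₁)
    (s₂ : IsLinearSolution j ν a b u₀ (fun t => g t - G (U₂ t)) u₂ U₂) :
    (∀ t ∈ Icc a b, u₁ t = u₂ t) ∧ U₁ =ᵐ[volume.restrict (Ioc a b)] U₂ := by
  obtain ⟨κ, hκ, hc⟩ := hG.exists_contraction hν
  obtain ⟨K, hK⟩ := hG.lipschitz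
  have m₁ := hg.sub (memLp_lipschitz_comp hK s₁.memLp)
  have m₂ := hg.sub (memLp_lipschitz_comp hK s₂.memLp)
  set M := ν⁻¹ * ∫ r in Ioc a b, ‖g r - G (U₁ r) - (g r - G (U₂ r))‖ ^ 2
  have hM : 0 ≤ M := mul_nonneg (inv_nonneg.2 hν.le) (integral_nonneg fun _ => sq_nonneg _)
  have key : ∀ n : ℕ, ∀ t ∈ Icc a b, ‖u₁ t - u₂ t‖ ^ 2 + ν * ∫ s in a..t, ‖U₁ s - U₂ s‖ ^ 2 ≤
      M / 2 ^ n * Real.exp (κ * (t - a)) := by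
    intro n
    induction n with
    | zero =>
      intro t ht
      refine (s₁.estimate_sub hν hab s₂ m₁ m₂ ht).trans ?_
      have h1 := mul_le_mul_of_nonneg_left (integral_le_of_mem_Icc
        (memLp_integrable_norm_sq (m₁.sub m₂)) (fun _ => sq_nonneg _) ht) (inv_nonneg.2 hν.le)
      refine h1.trans ?_
      rw [pow_zero, div_one]
      exact le_mul_of_one_le_right hM (Real.one_le_exp (mul_nonneg hκ.le (by linarith [ht.1])))
    | succ n ih =>
      intro t ht
      have := hc hab hg s₁.memLp s₂.memLp s₁.ae_eq s₂.ae_eq s₁ s₂ ih t ht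
      rwa [div_div, ← pow_succ] at this
  have key' : ∀ t ∈ Icc a b, ‖u₁ t - u₂ t‖ ^ 2 + ν * ∫ s in a..t, ‖U₁ s - U₂ s‖ ^ 2 ≤ 0 := by
    intro t ht
    refine ge_of_tendsto' (x := atTop) (f := fun n : ℕ => M / 2 ^ n * Real.exp (κ * (t - a))) ?_
      fun n => key n t ht
    have h1 : Tendsto (fun n : ℕ => M * (1 / 2 : ℝ) ^ n * Real.exp (κ * (t - a))) atTop
        (𝓝 (M * 0 * Real.exp (κ * (t - a)))) :=
      ((tendsto_pow_atTop_nhds_zero_of_lt_one (by norm_num) (by norm_num)).const_mul M).mul_const _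
    simpa [div_eq_mul_inv] using h1
  have hi0 : ∀ t ∈ Icc a b, 0 ≤ ν * ∫ s in a..t, ‖U₁ s - U₂ s‖ ^ 2 := fun t ht =>
    mul_nonneg hν.le (intervalIntegral.integral_nonneg ht.1 fun _ _ => sq_nonneg _)
  constructor
  · intro t ht
    have h1 := key' t ht
    have h2 : ‖u₁ t - u₂ t‖ ^ 2 = 0 :=
      le_antisymm (by linarith [hi0 t ht]) (sq_nonneg _)
    exact sub_eq_zero.1 (norm_eq_zero.1 ((pow_eq_zero_iff two_ne_zero).1 h2))
  · have hb := right_mem_Icc.2 hab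
    have h1 : ν * ∫ s in a..b, ‖U₁ s - U₂ s‖ ^ 2 = 0 :=
      le_antisymm (by linarith [key' b hb, sq_nonneg ‖u₁ b - u₂ b‖]) (hi0 b hb)
    have h2 := (mul_eq_zero.1 h1).resolve_left hν.ne'
    have hi : Integrable (fun s => ‖U₁ s - U₂ s‖ ^ 2) (volume.restrict (Ioc a b)) :=
      memLp_integrable_norm_sq (s₁.memLp.sub s₂.memLp)
    rw [intervalIntegral.integral_of_le hab, integral_eq_zero_iff_of_nonneg
      (fun _ => sq_nonneg _) hi] at h2
    filter_upwards [h2] with t ht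
    exact sub_eq_zero.1 (norm_eq_zero.1 ((pow_eq_zero_iff two_ne_zero).1 ht))

/-- Picard iteration on the L²(V) component. The contraction lives in a weighted norm that also sees
`u`, so it is used only to make the iterates Cauchy; the limit is a fixed point because the
iteration map is continuous in L²(V). -/
theorem exists_semilinearSolution {G : V → V} (hG : IsLowerOrder j G) (hν : 0 < ν)
    (hab : a ≤ b) {u₀ : H} (hu₀ : u₀ ∈ closure (Set.range j)) {g : ℝ → V}
    (hg : MemLp g 2 (volume.restrict (Ioc a b))) :
    ∃ u U, IsLinearSolution j ν a b u₀ (fun t => g t - G (U t)) u U := by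
  obtain ⟨κ, hκ, hc⟩ := hG.exists_contraction hν
  obtain ⟨K, hK⟩ := hG.lipschitz
  have mG : ∀ W : Lp V 2 (volume.restrict (Ioc a b)),
      MemLp (fun t => g t - G (W t)) 2 (volume.restrict (Ioc a b)) := fun W =>
    hg.sub (memLp_lipschitz_comp hK (Lp.memLp W))
  choose u U hs _ using fun W => exists_linearSolution (j := j) hν hab hu₀ (mG W)
  set Φ : Lp V 2 (volume.restrict (Ioc a b)) → Lp V 2 (volume.restrict (Ioc a b)) :=
    fun W => (hs W).memLp.toLp (U W) with hΦ
  have coeΦ : ∀ W, Φ W =ᵐ[volume.restrict (Ioc a b)] U W := fun W => (hs W).memLp.coeFn_toLp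
  have hb := right_mem_Icc.2 hab
  have distΦ : ∀ W W', dist (Φ W) (Φ W') ^ 2 = ∫ s in a..b, ‖U W s - U W' s‖ ^ 2 := by
    intro W W'
    rw [dist_eq_norm, hΦ, ← MemLp.toLp_sub, toLp_norm_sq, intervalIntegral.integral_of_le hab]
    rfl
  have contΦ : Continuous Φ := by
    refine LipschitzWith.continuous (K := (ν⁻¹).toNNReal * K)
      (LipschitzWith.of_dist_le_mul fun W W' => ?_)
    refine abs_le_of_sq_le_sq' ?_ (by positivity) |>.2
    have h1 := (hs W).estimate_sub hν hab (hs W') (mG W) (mG W') hb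
    rw [← distΦ] at h1
    have h2 : ∫ r in a..b, ‖g r - G (W r) - (g r - G (W' r))‖ ^ 2 ≤ K ^ 2 * dist W W' ^ 2 := by
      rw [dist_eq_norm, Lp_norm_sq, ← integral_const_mul, intervalIntegral.integral_of_le hab]
      refine integral_mono_ae (memLp_integrable_norm_sq ((mG W).sub (mG W')))
        ((memLp_integrable_norm_sq (Lp.memLp (W - W'))).const_mul _) ?_
      filter_upwards [Lp.coeFn_sub W W'] with r hr
      simp only [hr, Pi.sub_apply, sub_sub_sub_cancel_left]
      rw [norm_sub_rev, ← mul_pow]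
      gcongr
      simpa only [dist_eq_norm] using hK.dist_le_mul (W r) (W' r)
    have h3 : ν * dist (Φ W) (Φ W') ^ 2 ≤ ν⁻¹ * (K ^ 2 * dist W W' ^ 2) :=
      (le_trans (by linarith [sq_nonneg ‖u W b - u W' b‖]) h1).trans
        (mul_le_mul_of_nonneg_left h2 (inv_nonneg.2 hν.le))
    have h4 := mul_le_mul_of_nonneg_left h3 (inv_nonneg.2 hν.le)
    rw [inv_mul_cancel_left₀ hν.ne'] at h4
    refine h4.trans (le_of_eq ?_)
    rw [NNReal.coe_mul, Real.coe_toNNReal _ (inv_nonneg.2 hν.le)]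
    ring
  set W : ℕ → Lp V 2 (volume.restrict (Ioc a b)) := fun n => Φ^[n] 0 with hW
  have W_succ : ∀ n, W (n + 1) = Φ (W n) := fun n => Function.iterate_succ_apply' Φ n 0
  set M := ν⁻¹ * ∫ r in Ioc a b, ‖g r - G (W 1 r) - (g r - G (W 0 r))‖ ^ 2
  have hM : 0 ≤ M := mul_nonneg (inv_nonneg.2 hν.le) (integral_nonneg fun _ => sq_nonneg _)
  have key : ∀ n : ℕ, ∀ t ∈ Icc a b, ‖u (W (n + 1)) t - u (W n) t‖ ^ 2
      + ν * ∫ s in a..t, ‖U (W (n + 1)) s - U (W n) s‖ ^ 2 ≤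
      M / 2 ^ n * Real.exp (κ * (t - a)) := by
    intro n
    induction n with
    | zero =>
      intro t ht
      refine ((hs (W 1)).estimate_sub hν hab (hs (W 0)) (mG _) (mG _) ht).trans ?_
      have h1 := mul_le_mul_of_nonneg_left (integral_le_of_mem_Icc
        (memLp_integrable_norm_sq ((mG (W 1)).sub (mG (W 0)))) (fun _ => sq_nonneg _) ht)
        (inv_nonneg.2 hν.le)
      refine h1.trans ?_
      rw [pow_zero, div_one]
      exact le_mul_of_one_le_right hM (Real.one_le_exp (mul_nonneg hκ.le (by linarith [ht.1])))
    | succ n ih =>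
      intro t ht
      -- An iterate agrees with the solution it came from only almost everywhere, so the data have
      -- to be exchanged before the contraction applies.
      have c : ∀ k, (fun t => g t - G (W (k + 1) t)) =ᵐ[volume.restrict (Ioc a b)]
          fun t => g t - G (U (W k) t) := fun k => by
        rw [W_succ]
        filter_upwards [coeΦ (W k)] with t ht using by rw [ht]
      have := hc hab hg (hs (W (n + 1))).memLp (hs (W n)).memLp (hs (W (n + 1))).ae_eq
        (hs (W n)).ae_eq
        ((hs (W (n + 1 + 1))).congr hab (c (n + 1)) (fun _ _ => rfl) EventuallyEq.rfl)
        ((hs (W (n + 1))).congr hab (c n) (fun _ _ => rfl) EventuallyEq.rfl) ih t ht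
      rwa [div_div, ← pow_succ] at this
  have hdist : ∀ n, dist (W (n + 1)) (W (n + 2)) ≤
      √(ν⁻¹ * (M * Real.exp (κ * (b - a)))) * √(1 / 2) ^ n := by
    intro n
    refine abs_le_of_sq_le_sq' ?_ (by positivity) |>.2
    rw [mul_pow, Real.sq_sqrt (by positivity), ← pow_mul, mul_comm n 2, pow_mul,
      Real.sq_sqrt (by positivity), dist_comm, W_succ (n + 1), W_succ n, distΦ]
    have h1 := key n b hb
    rw [W_succ n] at h1
    have h2 : ν * ∫ s in a..b, ‖U (Φ (W n)) s - U (W n) s‖ ^ 2 ≤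
        M / 2 ^ n * Real.exp (κ * (b - a)) :=
      le_trans (by linarith [sq_nonneg ‖u (Φ (W n)) b - u (W n) b‖]) h1
    have h3 := mul_le_mul_of_nonneg_left h2 (inv_nonneg.2 hν.le)
    rw [inv_mul_cancel_left₀ hν.ne'] at h3
    refine h3.trans (le_of_eq ?_)
    rw [one_div, inv_pow]
    ring
  -- The starting iterate `0` is not the component of a solution, so the geometric bound begins at
  -- index one.
  have hcau : CauchySeq fun n => W (n + 1) :=
    cauchySeq_of_le_geometric _ _ (by
      rw [Real.sqrt_lt' one_pos]; norm_num) hdist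
  obtain ⟨Z, hZ⟩ := cauchySeq_tendsto_of_complete hcau
  have hfix : Φ Z = Z := isFixedPt_of_tendsto_iterate
    ((tendsto_add_atTop_iff_nat (f := W) 1).1 hZ) contΦ.continuousAt
  refine ⟨u Z, U Z, (hs Z).congr hab ?_ (fun _ _ => rfl) EventuallyEq.rfl⟩
  have h1 := coeΦ Z
  rw [hfix] at h1
  filter_upwards [h1] with t ht using by rw [ht]

/-- Solutions on `[a, a + n]` agree on overlaps by uniqueness. At time `t` the one with index `⌈t -
a⌉₊` is used, the first whose interval reaches `t`. -/
theorem exists_global_semilinearSolution {G : V → V} (hG : IsLowerOrder j G) (hν : 0 < ν)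
    {u₀ : H} (hu₀ : u₀ ∈ closure (Set.range j)) {g : ℝ → V}
    (hg : ∀ b, MemLp g 2 (volume.restrict (Ioc a b))) :
    ∃ u U, ∀ b, a ≤ b → IsLinearSolution j ν a b u₀ (fun t => g t - G (U t)) u U := by
  have hn : ∀ n : ℕ, a ≤ a + n := fun n => le_add_of_nonneg_right n.cast_nonneg
  choose u U hs using fun n : ℕ => exists_semilinearSolution hG hν (hn n) hu₀ (hg (a + n))
  have hu : ∀ k n : ℕ, k ≤ n → (∀ t ∈ Icc a (a + k), u k t = u n t) ∧
      U k =ᵐ[volume.restrict (Ioc a (a + k))] U n := by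
    intro k n hkn
    have hkn' : (a + k : ℝ) ≤ a + n := by gcongr
    exact (hs k).semilinear_unique hG hν (hn k) (hg _) ((hs n).restrict hkn')
  refine ⟨fun t => u ⌈t - a⌉₊ t, fun t => U ⌈t - a⌉₊ t, fun b hab => ?_⟩
  set n := ⌈b - a⌉₊
  have hbn : b ≤ a + n := by linarith [Nat.le_ceil (b - a)]
  have hceil : ∀ t ∈ Icc a b, ⌈t - a⌉₊ ≤ n ∧ t ∈ Icc a (a + ⌈t - a⌉₊) := fun t ht =>
    ⟨Nat.ceil_mono (by linarith [ht.2]), ht.1, by linarith [Nat.le_ceil (t - a)]⟩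
  have hU : U n =ᵐ[volume.restrict (Ioc a b)] fun t => U ⌈t - a⌉₊ t := by
    -- All indices are put under a single null set, since the index inserted below depends on `t`.
    have h1 : ∀ᵐ t ∂(volume : Measure ℝ), ∀ k ≤ n, t ∈ Ioc a (a + k) → U k t = U n t := by
      rw [ae_all_iff]
      intro k
      by_cases hk : k ≤ n
      · have h2 := (hu k n hk).2
        rw [EventuallyEq, ae_restrict_iff' measurableSet_Ioc] at h2
        filter_upwards [h2] with t ht _ using ht
      · exact ae_of_all _ fun t h => absurd h hk
    rw [EventuallyEq, ae_restrict_iff' measurableSet_Ioc]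
    filter_upwards [h1] with t ht htab
    obtain ⟨h3, h4⟩ := hceil t (Ioc_subset_Icc_self htab)
    exact (ht _ h3 ⟨htab.1, h4.2⟩).symm
  refine ((hs n).restrict hbn).congr hab (hU.mono fun t ht => by simp only [ht])
    (fun t ht => ?_) hU
  obtain ⟨h3, h4⟩ := hceil t ht
  exact ((hu _ n h3).1 t h4).symm

end Semilinear

/-! ### Ladyzhenskaya's inequality. -/

section Sobolev

/-- Cauchy–Schwarz applied to `|f| · |f|³`. -/
theorem eLpNorm_four_pow_le {α F : Type*} [MeasurableSpace α] {μ : Measure α}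
    [NormedAddCommGroup F] {f : α → F} (hf : AEStronglyMeasurable f μ) :
    eLpNorm f 4 μ ^ 4 ≤ eLpNorm f 2 μ * eLpNorm f 6 μ ^ 3 := by
  have h2 : ENNReal.toReal 2 = 2 := by norm_num
  have h4 : ENNReal.toReal 4 = 4 := by norm_num
  have h6 : ENNReal.toReal 6 = 6 := by norm_num
  rw [eLpNorm_eq_lintegral_rpow_enorm_toReal (by norm_num) (by norm_num),
    eLpNorm_eq_lintegral_rpow_enorm_toReal (by norm_num) (by norm_num),
    eLpNorm_eq_lintegral_rpow_enorm_toReal (by norm_num) (by norm_num), h2, h4, h6]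
  have h := ENNReal.lintegral_mul_le_Lp_mul_Lq μ Real.HolderConjugate.two_two
    hf.enorm (hf.enorm.pow_const 3)
  have e1 : ∫⁻ x, ‖f x‖ₑ ^ (4 : ℝ) ∂μ = ∫⁻ x, ((fun x => ‖f x‖ₑ) * fun x => ‖f x‖ₑ ^ 3) x ∂μ := by
    refine lintegral_congr fun x => ?_
    rw [Pi.mul_apply, ← pow_succ', ← ENNReal.rpow_natCast]
    norm_num
  have e2 : ∫⁻ x, (‖f x‖ₑ ^ 3) ^ (2 : ℝ) ∂μ = ∫⁻ x, ‖f x‖ₑ ^ (6 : ℝ) ∂μ := by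
    refine lintegral_congr fun x => ?_
    rw [← ENNReal.rpow_natCast, ← ENNReal.rpow_mul]
    norm_num
  rw [← e1, e2] at h
  rw [← ENNReal.rpow_natCast, ← ENNReal.rpow_natCast, ← ENNReal.rpow_mul, ← ENNReal.rpow_mul]
  norm_num at h ⊢
  exact h

theorem norm_fderiv_le_norm_jac (φ : E3 → E3) (x : E3) : ‖fderiv ℝ φ x‖ ≤ ‖jac φ x‖ := by
  refine ContinuousLinearMap.opNorm_le_bound _ (norm_nonneg _) fun y => ?_
  refine abs_le_of_sq_le_sq' ?_ (by positivity) |>.2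
  have hy : ∀ i, fderiv ℝ φ x y i = ∑ k, jac φ x (i, k) * y k := by
    intro i
    have h1 : y = ∑ k, y k • EuclideanSpace.single k (1 : ℝ) := by
      ext l
      simp [Finset.sum_apply, Pi.single_apply]
    conv_lhs => rw [h1]
    simp [jac, map_sum, mul_comm]
  rw [mul_pow, EuclideanSpace.real_norm_sq_eq, EuclideanSpace.real_norm_sq_eq,
    EuclideanSpace.real_norm_sq_eq, Fintype.sum_prod_type, Finset.sum_mul]
  refine Finset.sum_le_sum fun i _ => ?_
  rw [hy]
  exact Finset.sum_mul_sq_le_sq_mul_sq _ _ _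

variable {Ω : Opens E3}

theorem continuous_jac (φ : 𝓓(Ω, E3)) : Continuous (jac φ) := by
  have h1 := φ.contDiff.continuous_fderiv (by simp)
  refine (PiLp.continuous_toLp 2 _).comp (continuous_pi fun p => ?_)
  exact (EuclideanSpace.proj (𝕜 := ℝ) p.1).continuous.comp (h1.clm_apply continuous_const)

theorem support_jac_subset (φ : 𝓓(Ω, E3)) : Function.support (jac φ) ⊆ Ω := by
  intro x hx
  refine φ.tsupport_subset (support_fderiv_subset ℝ (f := φ) fun h => hx ?_)
  ext p
  simp [jac, h]

theorem hasCompactSupport_jac (φ : 𝓓(Ω, E3)) : HasCompactSupport (jac φ) := by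
  refine φ.hasCompactSupport.mono' fun x hx => ?_
  refine support_fderiv_subset ℝ (f := φ) fun h => hx ?_
  ext p
  simp [jac, h]

/-- Interpolation of L⁴ between L² and L⁶, followed by the Sobolev embedding into L⁶. Test fields
are compactly supported on the whole space, so the constant does not depend on `Ω`. -/
theorem exists_ladyzhenskaya_const : ∃ K : ℝ≥0, ∀ (Ω : Opens E3) (φ : 𝓓(Ω, E3)),
    eLpNorm φ 4 (volume.restrict (Ω : Set E3)) ^ 4 ≤
      K * eLpNorm φ 2 (volume.restrict (Ω : Set E3)) *
        eLpNorm (jac φ) 2 (volume.restrict (Ω : Set E3)) ^ 3 := by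
  set C := eLpNormLESNormFDerivOfEqInnerConst (volume : Measure E3) (2 : ℝ≥0)
  refine ⟨C ^ 3, fun Ω φ => ?_⟩
  have h1 := eLpNorm_four_pow_le (μ := volume.restrict (Ω : Set E3))
    φ.continuous.aestronglyMeasurable
  have h2 : eLpNorm φ 6 volume ≤ C * eLpNorm (fderiv ℝ φ) 2 volume := by
    have := eLpNorm_le_eLpNorm_fderiv_of_eq_inner (μ := (volume : Measure E3)) (u := φ)
      (φ.contDiff.of_le (by simp)) φ.hasCompactSupport (p := 2) (p' := 6) (by norm_num)
      (by simp) (by simp; norm_num)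
    exact_mod_cast this
  have h3 : eLpNorm (fderiv ℝ φ) 2 volume ≤ eLpNorm (jac φ) 2 (volume.restrict (Ω : Set E3)) := by
    rw [eLpNorm_restrict_eq_of_support_subset (support_jac_subset φ)]
    exact eLpNorm_mono fun x => norm_fderiv_le_norm_jac φ x
  have h4 : eLpNorm φ 6 (volume.restrict (Ω : Set E3)) ≤
      C * eLpNorm (jac φ) 2 (volume.restrict (Ω : Set E3)) :=
    (eLpNorm_mono_measure _ Measure.restrict_le_self).trans (h2.trans (by gcongr))
  refine h1.trans ((mul_le_mul_right (pow_le_pow_left' h4 3) _).trans (le_of_eq ?_))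
  rw [mul_pow, ENNReal.coe_pow]
  ring

/-- The closure of the graph of the gradient satisfies Ladyzhenskaya's inequality. -/
theorem exists_eLpNorm_four_le : ∃ K : ℝ, 0 ≤ K ∧ ∀ (Ω : Opens E3) (S : Submodule ℝ 𝓓(Ω, E3)),
    ∀ w ∈ (graphOf S).topologicalClosure,
      eLpNorm w.fst 4 (volume.restrict (Ω : Set E3)) ≤
        ENNReal.ofReal ((K * ‖w.fst‖ * ‖w.snd‖ ^ 3) ^ (1 / 4 : ℝ)) := by
  obtain ⟨K, hK⟩ := exists_ladyzhenskaya_const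
  refine ⟨K, K.coe_nonneg, fun Ω S w hw => ?_⟩
  have hgraph : ∀ w ∈ graphOf S, eLpNorm w.fst 4 (volume.restrict (Ω : Set E3)) ≤
        ENNReal.ofReal ((K * ‖w.fst‖ * ‖w.snd‖ ^ 3) ^ (1 / 4 : ℝ)) := by
    rintro w ⟨φ, -, h1, h2⟩
    have h3 := hK Ω φ
    rw [← eLpNorm_congr_ae h1, ← eLpNorm_congr_ae h1, ← eLpNorm_congr_ae h2, ← Lp.enorm_def,
      ← Lp.enorm_def, ← ofReal_norm, ← ofReal_norm, ← ENNReal.ofReal_coe_nnreal,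
      ← ENNReal.ofReal_pow (norm_nonneg _), ← ENNReal.ofReal_mul K.coe_nonneg,
      ← ENNReal.ofReal_mul (by positivity)] at h3
    rw [← ENNReal.ofReal_rpow_of_nonneg (by positivity) (by norm_num), one_div,
      ENNReal.le_rpow_inv_iff (by norm_num)]
    exact_mod_cast h3
  obtain ⟨x, hx, hxw⟩ := mem_closure_iff_seq_limit.1 hw
  have t1 : Tendsto (fun n => (x n).fst) atTop (𝓝 w.fst) :=
    ((WithLp.continuous_fst 2 _ _).tendsto w).comp hxw
  have t2 : Tendsto (fun n => (x n).snd) atTop (𝓝 w.snd) :=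
    ((WithLp.continuous_snd 2 _ _).tendsto w).comp hxw
  have t3 : Tendsto (fun n => (K * ‖(x n).fst‖ * ‖(x n).snd‖ ^ 3) ^ (1 / 4 : ℝ)) atTop
      (𝓝 ((K * ‖w.fst‖ * ‖w.snd‖ ^ 3) ^ (1 / 4 : ℝ))) :=
    ((t1.norm.const_mul _).mul (t2.norm.pow 3)).rpow_const (Or.inr (by norm_num))
  -- Fatou's lemma along an almost everywhere convergent subsequence passes the bound to the
  -- closure.
  obtain ⟨ns, hns, hae⟩ := (tendstoInMeasure_of_tendsto_Lp t1).exists_seq_tendsto_ae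
  refine (Lp.eLpNorm_lim_le_liminf_eLpNorm (fun n => Lp.aestronglyMeasurable _) _ hae).trans ?_
  have t4 := (ENNReal.tendsto_ofReal t3).comp hns.tendsto_atTop
  rw [← t4.liminf_eq]
  exact liminf_le_liminf (Eventually.of_forall fun n => hgraph _ (hx _))

end Sobolev

/-! ### The trilinear form and its antisymmetry. -/

section Trilinear

variable {Ω : Opens E3}

instance : Fact ((1 : ℝ≥0∞) ≤ 4) := ⟨by norm_num⟩

instance : ENNReal.HolderTriple 4 4 2 where
  inv_add_inv_eq_inv := by
    rw [← two_mul, show (4 : ℝ≥0∞) = 2 * 2 by norm_num,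
      ENNReal.mul_inv (Or.inl two_ne_zero) (Or.inl ENNReal.ofNat_ne_top), ← mul_assoc,
      ENNReal.mul_inv_cancel two_ne_zero ENNReal.ofNat_ne_top, one_mul]

theorem memLp_four (U : V Ω) : MemLp U.1.fst 4 (volume.restrict (Ω : Set E3)) := by
  obtain ⟨K, -, hK⟩ := exists_eLpNorm_four_le
  exact ⟨Lp.aestronglyMeasurable _, (hK Ω _ U.1 U.2).trans_lt ENNReal.ofReal_lt_top⟩

theorem exists_norm_four_pow_le : ∃ K : ℝ, 0 ≤ K ∧ ∀ (Ω : Opens E3) (U : V Ω),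
    ‖(memLp_four U).toLp U.1.fst‖ ^ 4 ≤ K * ‖U.1.fst‖ * ‖U.1.snd‖ ^ 3 := by
  obtain ⟨K, hK0, hK⟩ := exists_eLpNorm_four_le
  refine ⟨K, hK0, fun Ω U => ?_⟩
  have h := hK Ω _ U.1 U.2
  have h0 : 0 ≤ K * ‖U.1.fst‖ * ‖U.1.snd‖ ^ 3 := by positivity
  rw [Lp.norm_toLp]
  have h1 := ENNReal.toReal_le_of_le_ofReal (by positivity) h
  calc _ ≤ ((K * ‖U.1.fst‖ * ‖U.1.snd‖ ^ 3) ^ (1 / 4 : ℝ)) ^ 4 := by gcongr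
    _ = K * ‖U.1.fst‖ * ‖U.1.snd‖ ^ 3 := by
      rw [← Real.rpow_natCast, ← Real.rpow_mul h0]
      norm_num

/-- The inclusion of `V` into `L²(Ω; ℝ³)`. -/
noncomputable def valueL2 (Ω : Opens E3) : V Ω →L[ℝ] L2 Ω E3 := (WithLp.fstL 2 ℝ _ _).comp (V Ω).subtypeL

/-- The gradient `V → L²(Ω; ℝ^{3×3})`. -/
noncomputable def gradL2 (Ω : Opens E3) : V Ω →L[ℝ] L2 Ω M3 := (WithLp.sndL 2 ℝ _ _).comp (V Ω).subtypeL

theorem gradL2_apply (U : V Ω) : gradL2 Ω U = U.1.snd := rfl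

theorem inner_V (U W : V Ω) : ⟪U, W⟫ = ⟪U.1.fst, W.1.fst⟫ + ⟪U.1.snd, W.1.snd⟫ := by
  rw [Submodule.coe_inner, WithLp.prod_inner_apply]
  rfl

theorem norm_sq_V (U : V Ω) : ‖U‖ ^ 2 = ‖U.1.fst‖ ^ 2 + ‖U.1.snd‖ ^ 2 := by
  rw [Submodule.coe_norm, WithLp.prod_norm_sq_eq_of_L2]

theorem exists_norm_four_le : ∃ K : ℝ, ∀ (Ω : Opens E3) (U : V Ω),
    ‖(memLp_four U).toLp U.1.fst‖ ≤ K * ‖U‖ := by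
  obtain ⟨K, hK0, hK⟩ := exists_norm_four_pow_le
  refine ⟨K ^ (1 / 4 : ℝ), fun Ω U => ?_⟩
  have h1 : ‖U.1.fst‖ ≤ ‖U‖ :=
    abs_le_of_sq_le_sq' (by linarith [norm_sq_V U, sq_nonneg ‖U.1.snd‖]) (norm_nonneg _) |>.2
  have h2 : ‖U.1.snd‖ ≤ ‖U‖ :=
    abs_le_of_sq_le_sq' (by linarith [norm_sq_V U, sq_nonneg ‖U.1.fst‖]) (norm_nonneg _) |>.2
  refine le_of_pow_le_pow_left₀ four_ne_zero (by positivity) ((hK Ω U).trans ?_)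
  have h3 : (K ^ (1 / 4 : ℝ)) ^ 4 = K := by
    rw [← Real.rpow_natCast, ← Real.rpow_mul hK0]
    norm_num
  rw [mul_pow, h3]
  calc K * ‖U.1.fst‖ * ‖U.1.snd‖ ^ 3 ≤ K * ‖U‖ * ‖U‖ ^ 3 := by gcongr
    _ = K * ‖U‖ ^ 4 := by ring

/-- The inclusion of `V` into `L⁴(Ω; ℝ³)`, as a linear map. -/
noncomputable def valueL4Aux (Ω : Opens E3) :
    V Ω →ₗ[ℝ] Lp E3 4 (volume.restrict (Ω : Set E3)) where
  toFun U := (memLp_four U).toLp U.1.fst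
  map_add' U W := by
    rw [← MemLp.toLp_add]
    exact MemLp.toLp_congr _ _ (Lp.coeFn_add U.1.fst W.1.fst)
  map_smul' c U := by
    rw [RingHom.id_apply, ← MemLp.toLp_const_smul]
    exact MemLp.toLp_congr _ _ (Lp.coeFn_smul c U.1.fst)

/-- The inclusion of `V` into `L⁴(Ω; ℝ³)`. -/
noncomputable def valueL4 (Ω : Opens E3) : V Ω →L[ℝ] Lp E3 4 (volume.restrict (Ω : Set E3)) :=
  (valueL4Aux Ω).mkContinuousOfExistsBound (exists_norm_four_le.imp fun _ hK => hK Ω)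

theorem valueL4_apply (U : V Ω) : valueL4 Ω U = (memLp_four U).toLp U.1.fst := rfl

theorem coeFn_valueL4 (U : V Ω) : valueL4 Ω U =ᵐ[volume.restrict (Ω : Set E3)] U.1.fst :=
  (memLp_four U).coeFn_toLp

theorem normL4_eq (U : V Ω) : normL4 U.1.fst = ‖valueL4 Ω U‖ := (Lp.norm_toLp _ (memLp_four U)).symm

theorem exists_norm_valueL4_sq_le (Ω : Opens E3) {ε : ℝ} (hε : 0 < ε) :
    ∃ C ≥ 0, ∀ U : V Ω, ‖valueL4 Ω U‖ ^ 2 ≤ ε * ‖U‖ ^ 2 + C * ‖U.1.fst‖ ^ 2 := by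
  obtain ⟨K, hK0, hK⟩ := exists_norm_four_pow_le
  -- The constant is the one for which `(ε q² + C p²)² - K p q³` equals a square plus `(C p²)²`.
  refine ⟨K ^ 2 / (8 * ε ^ 3), by positivity, fun U => ?_⟩
  set p := ‖U.1.fst‖
  set q := ‖U.1.snd‖
  have hp : 0 ≤ p := norm_nonneg _
  have hq : 0 ≤ q := norm_nonneg _
  have h1 : (‖valueL4 Ω U‖ ^ 2) ^ 2 ≤ K * p * q ^ 3 := by
    rw [← pow_mul, valueL4_apply]; exact hK Ω U
  have h2 : K * p * q ^ 3 ≤ (ε * q ^ 2 + K ^ 2 / (8 * ε ^ 3) * p ^ 2) ^ 2 := by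
    have h3 : (ε * q ^ 2 + K ^ 2 / (8 * ε ^ 3) * p ^ 2) ^ 2 - K * p * q ^ 3 =
        q ^ 2 * (ε * q - K * p / (2 * ε)) ^ 2 + (K ^ 2 / (8 * ε ^ 3) * p ^ 2) ^ 2 := by
      field_simp
      ring
    have h4 : 0 ≤ q ^ 2 * (ε * q - K * p / (2 * ε)) ^ 2 + (K ^ 2 / (8 * ε ^ 3) * p ^ 2) ^ 2 := by
      positivity
    linarith
  have h5 := abs_le_of_sq_le_sq' (h1.trans h2) (by positivity) |>.2
  have h6 := norm_sq_V U
  nlinarith [mul_nonneg hε.le (sq_nonneg p)]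

/-- The bilinear map `(u, w) ↦ (w_i u_j)_{i, j}`. -/
noncomputable def outer : E3 →L[ℝ] E3 →L[ℝ] M3 :=
  (LinearMap.mk₂ ℝ (fun u w : E3 => (WithLp.toLp 2 fun p => u p.2 * w p.1 : M3))
    (fun _ _ _ => by ext; simp [add_mul]) (fun _ _ _ => by ext; simp [mul_assoc])
    (fun _ _ _ => by ext; simp [mul_add])
    (fun _ _ _ => by ext; simp [mul_left_comm])).toContinuousBilinearMap

theorem outer_apply (u w : E3) (p : Fin 3 × Fin 3) : outer u w p = u p.2 * w p.1 := rfl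

/-- The tensor product of two `L⁴` fields, as an `L²` field. -/
noncomputable def tensor (Ω : Opens E3) : Lp E3 4 (volume.restrict (Ω : Set E3)) →L[ℝ]
    Lp E3 4 (volume.restrict (Ω : Set E3)) →L[ℝ] L2 Ω M3 :=
  outer.holderL (volume.restrict (Ω : Set E3)) 4 4 2

theorem coeFn_tensor (F G : Lp E3 4 (volume.restrict (Ω : Set E3))) :
    tensor Ω F G =ᵐ[volume.restrict (Ω : Set E3)] fun x => outer (F x) (G x) :=
  outer.coeFn_holder (r := 2) F G

attribute [irreducible] tensor valueL4

theorem sum_integral_eq_integral_inner_outer {α : Type*} [MeasurableSpace α] {μ : Measure α}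
    {u w : α → E3} {g : α → M3} (hu : MemLp u 4 μ) (hw : MemLp w 4 μ) (hg : MemLp g 2 μ) :
    ∑ i, ∑ j, ∫ x, u x i * g x (j, i) * w x j ∂μ = ∫ x, ⟪g x, outer (u x) (w x)⟫ ∂μ := by
  have hc : ∀ i {F : α → E3}, MemLp F 4 μ → MemLp (fun x => F x i) 4 μ :=
    fun i F hF => (EuclideanSpace.proj (𝕜 := ℝ) i).comp_memLp' hF
  have hgc : ∀ p, MemLp (fun x => g x p) 2 μ :=
    fun p => (EuclideanSpace.proj (𝕜 := ℝ) p).comp_memLp' hg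
  have hi : ∀ i j, Integrable (fun x => u x i * g x (j, i) * w x j) μ := by
    intro i j
    have h1 : MemLp (fun x => u x i * w x j) 2 μ := (hc j hw).mul (hc i hu)
    refine (h1.integrable_mul (hgc (j, i))).congr (ae_of_all _ fun x => ?_)
    simp only [Pi.mul_apply]
    ring
  simp only [← integral_finsetSum _ fun j _ => hi _ j]
  rw [← integral_finsetSum _ fun i _ => integrable_finsetSum _ fun j _ => hi i j]
  refine integral_congr_ae (ae_of_all _ fun x => ?_)
  simp only
  rw [PiLp.inner_apply, Fintype.sum_prod_type, Finset.sum_comm]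
  refine Finset.sum_congr rfl fun j _ => Finset.sum_congr rfl fun i _ => ?_
  simp only [outer_apply, RCLike.inner_apply, conj_trivial]
  ring

/-- In this form continuity in all three arguments is immediate, and a gradient in the test slot can
be moved across by its adjoint. -/
theorem trilinear_eq (U W Z : V Ω) :
    trilinear U W Z = ⟪gradL2 Ω W, tensor Ω (valueL4 Ω U) (valueL4 Ω Z)⟫ := by
  refine (sum_integral_eq_integral_inner_outer (memLp_four U) (memLp_four Z)
    (Lp.memLp W.1.snd)).trans ?_
  rw [L2.inner_def]
  refine integral_congr_ae ?_
  filter_upwards [coeFn_tensor (valueL4 Ω U) (valueL4 Ω Z), coeFn_valueL4 U,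
    coeFn_valueL4 Z] with x h1 h2 h3
  rw [h1, h2, h3, gradL2_apply]

/-- Integration by parts of `f ∂ᵥ(p q)`; compact support of `f` alone makes every integrand
integrable. -/
theorem integral_mul_fderiv_mul {f p q : E3 → ℝ} (hf : ContDiff ℝ 1 f) (hp : ContDiff ℝ 1 p)
    (hq : ContDiff ℝ 1 q) (hcf : HasCompactSupport f) (v : E3) :
    (∫ x, f x * fderiv ℝ p x v * q x) + ∫ x, f x * fderiv ℝ q x v * p x =
      - ∫ x, fderiv ℝ f x v * (p x * q x) := by
  have df := (hf.continuous_fderiv (by simp)).clm_apply (continuous_const (y := v))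
  have dp := (hp.continuous_fderiv (by simp)).clm_apply (continuous_const (y := v))
  have dq := (hq.continuous_fderiv (by simp)).clm_apply (continuous_const (y := v))
  have cf := hf.continuous
  have cp := hp.continuous
  have cq := hq.continuous
  have hcdf : HasCompactSupport fun x => fderiv ℝ f x v := hcf.fderiv_apply ℝ v
  have hd : ∀ x, fderiv ℝ (fun x => p x * q x) x v = p x * fderiv ℝ q x v + q x * fderiv ℝ p x v := by
    intro x
    rw [fderiv_fun_mul (hp.differentiable (by simp) x) (hq.differentiable (by simp) x)]
    simp
  have i1 : Integrable fun x => f x * fderiv ℝ p x v * q x :=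
    Continuous.integrable_of_hasCompactSupport (by fun_prop) (hcf.mul_right.mul_right)
  have i2 : Integrable fun x => f x * fderiv ℝ q x v * p x :=
    Continuous.integrable_of_hasCompactSupport (by fun_prop) (hcf.mul_right.mul_right)
  have i3 : Integrable fun x => fderiv ℝ f x v * (p x * q x) :=
    Continuous.integrable_of_hasCompactSupport (by fun_prop) hcdf.mul_right
  have i4 : Integrable fun x => f x * (p x * q x) :=
    Continuous.integrable_of_hasCompactSupport (by fun_prop) hcf.mul_right
  have he : ∀ x, f x * fderiv ℝ (fun x => p x * q x) x v =
      f x * fderiv ℝ p x v * q x + f x * fderiv ℝ q x v * p x := fun x => by rw [hd]; ring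
  rw [← integral_mul_fderiv_eq_neg_fderiv_mul_of_integrable i3 (by
    simp only [he]; exact i1.add i2) i4 (fun x _ => hf.differentiable (by simp) x)
    (fun x _ => (hp.mul hq).differentiable (by simp) x), ← integral_add i1 i2]
  simp only [he]

theorem jac_apply (φ : 𝓓(Ω, E3)) (x : E3) (j i : Fin 3) :
    jac φ x (j, i) = fderiv ℝ (fun y => φ y j) x (EuclideanSpace.single i 1) := by
  have h := ((EuclideanSpace.proj (𝕜 := ℝ) j : E3 →L[ℝ] ℝ).hasFDerivAt.comp x
    (differentiable_test φ x).hasFDerivAt).fderiv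
  have h' : fderiv ℝ (fun y => φ y j) x = _ := h
  rw [h']
  rfl

/-- Integration by parts turns each pair of terms into `-∫ ∂ᵢφᵢ ψⱼ χⱼ`, and the sum over `i`
contains the divergence of `φ`. -/
theorem integral_solenoidal_eq_zero {φ ψ χ : 𝓓(Ω, E3)} (hφ : φ ∈ solenoidal Ω) :
    (∑ i, ∑ j, ∫ x, φ x i * jac ψ x (j, i) * χ x j) +
      ∑ i, ∑ j, ∫ x, φ x i * jac χ x (j, i) * ψ x j = 0 := by
  have hs : ∀ (φ : 𝓓(Ω, E3)) i, ContDiff ℝ 1 fun x => φ x i := fun φ i =>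
    (EuclideanSpace.proj (𝕜 := ℝ) i : E3 →L[ℝ] ℝ).contDiff.comp (φ.contDiff.of_le (by simp))
  have hc : ∀ i, HasCompactSupport fun x => φ x i := fun i =>
    φ.hasCompactSupport.comp_left (g := fun y : E3 => y i) rfl
  have h1 : ∀ i j, (∫ x, φ x i * jac ψ x (j, i) * χ x j) +
      ∫ x, φ x i * jac χ x (j, i) * ψ x j = - ∫ x, jac φ x (i, i) * (ψ x j * χ x j) := by
    intro i j
    simp only [jac_apply]
    exact integral_mul_fderiv_mul (hs φ i) (hs ψ j) (hs χ j) (hc i) _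
  simp only [← Finset.sum_add_distrib, h1]
  rw [Finset.sum_comm]
  refine Finset.sum_eq_zero fun j _ => ?_
  have hcj : ∀ p, Continuous fun x => jac φ x p := fun p =>
    (EuclideanSpace.proj (𝕜 := ℝ) p).continuous.comp (continuous_jac φ)
  have hint : ∀ i, Integrable fun x => jac φ x (i, i) * (ψ x j * χ x j) := fun i =>
    Continuous.integrable_of_hasCompactSupport
      ((hcj _).mul ((hs ψ j).continuous.mul (hs χ j).continuous))
      (HasCompactSupport.mul_right
        ((hasCompactSupport_jac φ).comp_left (g := fun y : M3 => y (i, i)) rfl))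
  rw [Finset.sum_neg_distrib, ← integral_finsetSum _ fun i _ => hint i, neg_eq_zero]
  refine integral_eq_zero_of_ae (ae_of_all _ fun x => ?_)
  have h2 : ∑ i, jac φ x (i, i) = 0 := hφ x
  simp only [← Finset.sum_mul, h2, zero_mul, Pi.zero_apply]

theorem exists_seq_graph (U : V Ω) : ∃ x : ℕ → V Ω,
    (∀ n, (x n).1 ∈ graphOf (solenoidal Ω)) ∧ Tendsto x atTop (𝓝 U) := by
  obtain ⟨x, hx, hxU⟩ := mem_closure_iff_seq_limit.1 U.2
  exact ⟨fun n => ⟨x n, subset_closure (hx n)⟩, hx, tendsto_subtype_rng.2 hxU⟩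

theorem tendsto_trilinear {x y z : ℕ → V Ω} {U W Z : V Ω} (hx : Tendsto x atTop (𝓝 U))
    (hy : Tendsto y atTop (𝓝 W)) (hz : Tendsto z atTop (𝓝 Z)) :
    Tendsto (fun n => trilinear (x n) (y n) (z n)) atTop (𝓝 (trilinear U W Z)) := by
  have tx := ((valueL4 Ω).continuous.tendsto _).comp hx
  have tz := ((valueL4 Ω).continuous.tendsto _).comp hz
  have ty := ((gradL2 Ω).continuous.tendsto _).comp hy
  have tT := ((tensor Ω).continuous₂.tendsto (_, _)).comp (tx.prodMk_nhds tz)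
  simp only [trilinear_eq]
  exact ty.inner tT

theorem trilinear_add_graph {U W Z : V Ω} (hU : U.1 ∈ graphOf (solenoidal Ω))
    (hW : W.1 ∈ graphOf (solenoidal Ω)) (hZ : Z.1 ∈ graphOf (solenoidal Ω)) :
    trilinear U W Z + trilinear U Z W = 0 := by
  obtain ⟨φ, hφ, h1, -⟩ := hU
  obtain ⟨ψ, -, h3, h4⟩ := hW
  obtain ⟨χ, -, h5, h6⟩ := hZ
  rw [← integral_solenoidal_eq_zero (ψ := ψ) (χ := χ) hφ]
  have hsupp : ∀ (η : 𝓓(Ω, E3)) (x : E3), x ∉ (Ω : Set E3) → η x = 0 := fun η x hxΩ =>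
    image_eq_zero_of_notMem_tsupport fun h => hxΩ (η.tsupport_subset h)
  -- Since `φ` vanishes outside `Ω`, integrating over `Ω` is the same as integrating over the whole
  -- space.
  have hset : ∀ (η θ : 𝓓(Ω, E3)) (i j : Fin 3), ∫ x, φ x i * jac η x (j, i) * θ x j =
      ∫ x in (Ω : Set E3), φ x i * jac η x (j, i) * θ x j := fun η θ i j =>
    (setIntegral_eq_integral_of_forall_compl_eq_zero fun x hxΩ => by
      rw [hsupp φ x hxΩ]; simp).symm
  simp only [hset]
  refine congrArg₂ _ ?_ ?_
  · refine Finset.sum_congr rfl fun i _ => Finset.sum_congr rfl fun j _ => integral_congr_ae ?_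
    filter_upwards [h1, h4, h5] with x e1 e2 e3
    rw [e1, e2, e3]
  · refine Finset.sum_congr rfl fun i _ => Finset.sum_congr rfl fun j _ => integral_congr_ae ?_
    filter_upwards [h1, h3, h6] with x e1 e2 e3
    rw [e1, e2, e3]

/-- Holds for solenoidal test fields and extends by density, all three arguments being approximated
simultaneously. -/
theorem trilinear_antisymm (U W Z : V Ω) : trilinear U W Z = - trilinear U Z W := by
  obtain ⟨x, hx, tx⟩ := exists_seq_graph U
  obtain ⟨y, hy, ty⟩ := exists_seq_graph W
  obtain ⟨z, hz, tz⟩ := exists_seq_graph Z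
  have hlim := (tendsto_trilinear tx ty tz).add (tendsto_trilinear tx tz ty)
  simp only [trilinear_add_graph (hx _) (hy _) (hz _)] at hlim
  linarith [tendsto_nhds_unique tendsto_const_nhds hlim]

theorem trilinear_self (U W : V Ω) : trilinear U W W = 0 := by
  linarith [trilinear_antisymm U W W]

end Trilinear

/-! ### Lipschitz continuity of the truncated quadratic term. -/

section Cutoff

theorem cutoff_eq {N r : ℝ} (hN : 0 < N) (hr : 0 ≤ r) : cutoff N r = N / max N r := by
  rw [cutoff]
  split_ifs with h
  · rw [h, max_eq_left hN.le, div_self hN.ne']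
  · have hr' : 0 < r := lt_of_le_of_ne hr (Ne.symm h)
    rcases le_total N r with h1 | h1
    · rw [max_eq_right h1, min_eq_right ((div_le_one hr').2 h1)]
    · rw [max_eq_left h1, div_self hN.ne', min_eq_left ((one_le_div hr').2 h1)]

theorem cutoff_nonneg {N r : ℝ} (hN : 0 < N) (hr : 0 ≤ r) : 0 ≤ cutoff N r := by
  rw [cutoff_eq hN hr]
  positivity

theorem cutoff_mul_le {N r : ℝ} (hN : 0 < N) (hr : 0 ≤ r) : cutoff N r * r ≤ N := by
  rw [cutoff_eq hN hr, div_mul_eq_mul_div, div_le_iff₀ (lt_max_of_lt_left hN)]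
  exact mul_le_mul_of_nonneg_left (le_max_right _ _) hN.le

/-- With `A = max N r` and `B = max N s`, the difference of the cut-offs is `N (A - B) / (A B)` in
absolute value, while `A - B ≤ r - s` and `s² ≤ A B`. -/
theorem abs_cutoff_sub_mul_sq_le {N r s : ℝ} (hN : 0 < N) (hs : 0 ≤ s) (hsr : s ≤ r) :
    |cutoff N r - cutoff N s| * s ^ 2 ≤ N * (r - s) := by
  rw [cutoff_eq hN hs, cutoff_eq hN (hs.trans hsr), abs_sub_comm]
  set A := max N r
  set B := max N s
  have hA : 0 < A := lt_max_of_lt_left hN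
  have hB : 0 < B := lt_max_of_lt_left hN
  have hBA : B ≤ A := max_le_max_left N hsr
  have hAB : A - B ≤ r - s := by
    rcases max_cases N r with ⟨h1, h2⟩ | ⟨h1, h2⟩
    · have : B = N := le_antisymm (hBA.trans_eq h1) (le_max_left _ _)
      rw [show A = N from h1, this]
      linarith
    · rw [show A = r from h1]
      linarith [le_max_right N s]
  have hd : N / B - N / A = N * (A - B) / (B * A) := by
    field_simp
  rw [hd, abs_of_nonneg (div_nonneg (mul_nonneg hN.le (by linarith)) (by positivity)),
    div_mul_eq_mul_div, div_le_iff₀ (by positivity)]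
  have h1 : s ^ 2 ≤ B * A := by
    rw [sq]
    exact mul_le_mul (le_max_right _ _) (hsr.trans (le_max_right _ _)) hs hB.le
  exact mul_le_mul (mul_le_mul_of_nonneg_left hAB hN.le) h1 (sq_nonneg _)
    (mul_nonneg hN.le (by linarith))

/-- Split the difference into three terms, changing one factor at a time. Taking `u` as the larger
vector lets `cutoff N ‖u‖` control a factor `u` or `v` in the first two, and leaves `‖v‖²`, the
smaller square, against the change of the cut-off. -/
theorem norm_cutoff_smul_sub_le {X Y : Type*} [NormedAddCommGroup X] [NormedSpace ℝ X]
    [NormedAddCommGroup Y] [NormedSpace ℝ Y] (T : X →L[ℝ] X →L[ℝ] Y) {N : ℝ} (hN : 0 < N)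
    (u v : X) :
    ‖cutoff N ‖u‖ • T u u - cutoff N ‖v‖ • T v v‖ ≤ 3 * N * ‖T‖ * ‖u - v‖ := by
  wlog h : ‖v‖ ≤ ‖u‖ generalizing u v
  · rw [norm_sub_rev, norm_sub_rev u v]
    exact this v u (le_of_not_ge h)
  have hT := norm_nonneg T
  have hu := norm_nonneg u
  have hv := norm_nonneg v
  have hd := norm_nonneg (u - v)
  have hc := cutoff_nonneg hN hu
  have e : cutoff N ‖u‖ • T u u - cutoff N ‖v‖ • T v v = cutoff N ‖u‖ • T u (u - v)
      + cutoff N ‖u‖ • T (u - v) v + (cutoff N ‖u‖ - cutoff N ‖v‖) • T v v := by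
    rw [map_sub, map_sub, sub_apply, smul_sub, smul_sub, sub_smul]
    abel
  have b1 : ‖cutoff N ‖u‖ • T u (u - v)‖ ≤ N * ‖T‖ * ‖u - v‖ := by
    rw [norm_smul, Real.norm_of_nonneg hc]
    calc _ ≤ cutoff N ‖u‖ * (‖T‖ * ‖u‖ * ‖u - v‖) := by gcongr; exact T.le_opNorm₂ _ _
      _ = (cutoff N ‖u‖ * ‖u‖) * (‖T‖ * ‖u - v‖) := by ring
      _ ≤ N * (‖T‖ * ‖u - v‖) := by gcongr; exact cutoff_mul_le hN hu
      _ = _ := by ring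
  have b2 : ‖cutoff N ‖u‖ • T (u - v) v‖ ≤ N * ‖T‖ * ‖u - v‖ := by
    rw [norm_smul, Real.norm_of_nonneg hc]
    calc _ ≤ cutoff N ‖u‖ * (‖T‖ * ‖u - v‖ * ‖u‖) := by
          gcongr
          exact (T.le_opNorm₂ _ _).trans (by gcongr)
      _ = (cutoff N ‖u‖ * ‖u‖) * (‖T‖ * ‖u - v‖) := by ring
      _ ≤ N * (‖T‖ * ‖u - v‖) := by gcongr; exact cutoff_mul_le hN hu
      _ = _ := by ring
  have b3 : ‖(cutoff N ‖u‖ - cutoff N ‖v‖) • T v v‖ ≤ N * ‖T‖ * ‖u - v‖ := by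
    rw [norm_smul, Real.norm_eq_abs]
    calc _ ≤ |cutoff N ‖u‖ - cutoff N ‖v‖| * (‖T‖ * ‖v‖ * ‖v‖) := by
          gcongr; exact T.le_opNorm₂ _ _
      _ = (|cutoff N ‖u‖ - cutoff N ‖v‖| * ‖v‖ ^ 2) * ‖T‖ := by ring
      _ ≤ N * (‖u‖ - ‖v‖) * ‖T‖ :=
        mul_le_mul_of_nonneg_right (abs_cutoff_sub_mul_sq_le hN hv h) hT
      _ ≤ N * ‖u - v‖ * ‖T‖ := by gcongr; exact norm_sub_norm_le _ _
      _ = _ := by ring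
  rw [e]
  refine (norm_add₃_le).trans ?_
  linarith

end Cutoff

/-! ### The truncated term as a lower-order perturbation, abstractly. -/

section ModifiedNonlinearity

variable {V H X W : Type*} [NormedAddCommGroup V] [InnerProductSpace ℝ V] [CompleteSpace V]
  [NormedAddCommGroup H] [InnerProductSpace ℝ H] [CompleteSpace H]
  [NormedAddCommGroup W] [InnerProductSpace ℝ W] [CompleteSpace W]
  [NormedAddCommGroup X] [NormedSpace ℝ X]
  (D : V →L[ℝ] W) (j : V →L[ℝ] H) (e : V →L[ℝ] X) (T : X →L[ℝ] X →L[ℝ] W)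

/-- The map `u ↦ - D* (F_N(‖e u‖) T(e u, e u)) - ν j* j u`. -/
noncomputable def modifiedNonlinearity (ν N : ℝ) (u : V) : V :=
  -D.adjoint (cutoff N ‖e u‖ • T (e u) (e u)) - ν • j.adjoint (j u)

theorem inner_modifiedNonlinearity (ν N : ℝ) (u v : V) :
    ⟪modifiedNonlinearity D j e T ν N u, v⟫ =
      cutoff N ‖e u‖ * -⟪D v, T (e u) (e u)⟫ - ν * ⟪j u, j v⟫ := by
  rw [modifiedNonlinearity, inner_sub_left, inner_neg_left, real_inner_smul_left,
    ContinuousLinearMap.adjoint_inner_left, ContinuousLinearMap.adjoint_inner_left,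
    real_inner_smul_left, real_inner_comm, mul_neg]

theorem isLowerOrder_modifiedNonlinearity (ν : ℝ) {N : ℝ} (hN : 0 < N)
    (he : ∀ ε > 0, ∃ C ≥ 0, ∀ u, ‖e u‖ ^ 2 ≤ ε * ‖u‖ ^ 2 + C * ‖j u‖ ^ 2) :
    IsLowerOrder j (modifiedNonlinearity D j e T ν N) := by
  intro ε hε
  set A := ‖D.adjoint‖ * (3 * N * ‖T‖)
  set B := |ν| * ‖j.adjoint‖
  -- Squaring `A x + B z` costs a factor two, and `2A² · ε/(2A² + 1) ≤ ε`; the `1` covers the case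
  -- `A = 0`.
  obtain ⟨C, hC, h⟩ := he (ε / (2 * A ^ 2 + 1)) (by positivity)
  refine ⟨2 * A ^ 2 * C + 2 * B ^ 2, by positivity, fun u v => ?_⟩
  have e1 : modifiedNonlinearity D j e T ν N u - modifiedNonlinearity D j e T ν N v =
      -D.adjoint (cutoff N ‖e u‖ • T (e u) (e u) - cutoff N ‖e v‖ • T (e v) (e v))
      - ν • j.adjoint (j u - j v) := by
    simp only [modifiedNonlinearity, map_sub, smul_sub]
    abel
  have b1 : ‖D.adjoint (cutoff N ‖e u‖ • T (e u) (e u) - cutoff N ‖e v‖ • T (e v) (e v))‖ ≤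
      A * ‖e (u - v)‖ := by
    refine (D.adjoint.le_opNorm _).trans ?_
    rw [map_sub, mul_assoc]
    exact mul_le_mul_of_nonneg_left (norm_cutoff_smul_sub_le _ hN _ _) (norm_nonneg _)
  have b2 : ‖ν • j.adjoint (j u - j v)‖ ≤ B * ‖j (u - v)‖ := by
    rw [norm_smul, Real.norm_eq_abs, mul_assoc, map_sub j]
    exact mul_le_mul_of_nonneg_left (j.adjoint.le_opNorm _) (abs_nonneg _)
  have b3 : ‖modifiedNonlinearity D j e T ν N u - modifiedNonlinearity D j e T ν N v‖ ≤
      A * ‖e (u - v)‖ + B * ‖j (u - v)‖ := by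
    rw [e1]
    refine (norm_sub_le _ _).trans ?_
    rw [norm_neg]
    exact add_le_add b1 b2
  have b4 := h (u - v)
  rw [← map_sub]
  set x := ‖e (u - v)‖
  set z := ‖j (u - v)‖
  have b6 : ‖modifiedNonlinearity D j e T ν N u - modifiedNonlinearity D j e T ν N v‖ ^ 2 ≤
      (A * x + B * z) ^ 2 := by gcongr
  have b7 : 2 * A ^ 2 * (ε / (2 * A ^ 2 + 1) * ‖u - v‖ ^ 2) ≤ ε * ‖u - v‖ ^ 2 := by
    have : 2 * A ^ 2 * (ε / (2 * A ^ 2 + 1)) ≤ ε := by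
      rw [← mul_div_assoc, div_le_iff₀ (by positivity)]
      nlinarith [sq_nonneg A]
    rw [← mul_assoc]
    exact mul_le_mul_of_nonneg_right this (sq_nonneg _)
  have b8 := mul_le_mul_of_nonneg_left b4 (by positivity : 0 ≤ 2 * A ^ 2)
  nlinarith [sq_nonneg (A * x - B * z)]

end ModifiedNonlinearity

/-! ### The concrete operators on `V` and `H`. -/

section Operators

variable {Ω : Opens E3}

theorem fst_mem_H (U : V Ω) : U.1.fst ∈ H Ω := by
  refine map_mem_closure (WithLp.continuous_fst 2 _ _) U.2 ?_
  rintro w ⟨φ, hφ, h1, -⟩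
  exact ⟨φ, hφ, h1⟩

/-- The inclusion of `V` into `H`. -/
noncomputable def valueH (Ω : Opens E3) : V Ω →L[ℝ] H Ω :=
  (valueL2 Ω).codRestrict (H Ω) fst_mem_H

theorem inner_valueH (u : H Ω) (v : V Ω) : ⟪u, valueH Ω v⟫ = ⟪(u : L2 Ω E3), v.1.fst⟫ := rfl

theorem memLp_of_test {F : Type*} [NormedAddCommGroup F] {φ : E3 → F} (h : Continuous φ)
    (hc : HasCompactSupport φ) : MemLp φ 2 (volume.restrict (Ω : Set E3)) :=
  (h.memLp_of_hasCompactSupport hc).restrict _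

/-- Solenoidal test fields have square-integrable gradients, so they lie in `V`, and they are dense
in `H` by definition. -/
theorem mem_closure_range_valueH (u : H Ω) : u ∈ closure (Set.range (valueH Ω)) := by
  rw [closure_subtype]
  refine closure_mono ?_ u.2
  rintro w ⟨φ, hφ, hw⟩
  have h1 := memLp_of_test (Ω := Ω) (continuous_jac φ) (hasCompactSupport_jac φ)
  have h2 : WithLp.toLp 2 (w, h1.toLp (jac φ)) ∈ graphOf (solenoidal Ω) := by
    refine ⟨φ, hφ, hw, ?_⟩
    rw [WithLp.toLp_snd]
    exact h1.coeFn_toLp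
  exact ⟨_, ⟨⟨_, subset_closure h2⟩, rfl⟩, rfl⟩

/-- The nonlinear term `F_N(‖u‖_{L⁴}) B(u)` minus `ν u`, as an element of the Hilbert space `V`
with the `H¹` inner product. -/
noncomputable def nonlinearity (Ω : Opens E3) (ν N : ℝ) : V Ω → V Ω :=
  modifiedNonlinearity (gradL2 Ω) (valueH Ω) (valueL4 Ω) (tensor Ω) ν N

theorem inner_nonlinearity (ν N : ℝ) (U v : V Ω) : ⟪nonlinearity Ω ν N U, v⟫ =
    cutoff N (normL4 U.1.fst) * trilinear U U v - ν * ⟪U.1.fst, v.1.fst⟫ := by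
  have h : ⟪nonlinearity Ω ν N U, v⟫ = cutoff N ‖valueL4 Ω U‖ *
      -⟪gradL2 Ω v, tensor Ω (valueL4 Ω U) (valueL4 Ω U)⟫ - ν * ⟪valueH Ω U, valueH Ω v⟫ :=
    inner_modifiedNonlinearity (gradL2 Ω) (valueH Ω) (valueL4 Ω) (tensor Ω) ν N U v
  have h1 : cutoff N (normL4 U.1.fst) * trilinear U U v = cutoff N ‖valueL4 Ω U‖ *
      -⟪gradL2 Ω v, tensor Ω (valueL4 Ω U) (valueL4 Ω U)⟫ :=
    congrArg₂ (· * ·) (congrArg (cutoff N) (normL4_eq U))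
      ((trilinear_antisymm U U v).trans (congrArg Neg.neg (trilinear_eq U v U)))
  have h2 : ⟪valueH Ω U, valueH Ω v⟫ = ⟪U.1.fst, v.1.fst⟫ := inner_valueH _ _
  exact h.trans (congrArg₂ (· - ·) h1.symm (congrArg (ν * ·) h2))

theorem isLowerOrder_nonlinearity (ν : ℝ) {N : ℝ} (hN : 0 < N) :
    IsLowerOrder (valueH Ω) (nonlinearity Ω ν N) :=
  isLowerOrder_modifiedNonlinearity _ _ _ _ _ hN fun _ hε => exists_norm_valueL4_sq_le Ω hε

/-- The element of `V` that represents the functional `v ↦ ∫ g · v`. -/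
noncomputable def forcing (Ω : Opens E3) : L2 Ω E3 →L[ℝ] V Ω :=
  ContinuousLinearMap.adjoint (valueL2 Ω)

theorem inner_forcing (g : L2 Ω E3) (v : V Ω) : ⟪forcing Ω g, v⟫ = ⟪g, v.1.fst⟫ :=
  ContinuousLinearMap.adjoint_inner_left (valueL2 Ω) v g

/-- The projection is self-adjoint and fixes fields of `V`, so it disappears from the weak equation.
-/
theorem inner_helmholtz (g : L2 Ω E3) (v : V Ω) : ⟪helmholtz Ω g, v.1.fst⟫ = ⟪g, v.1.fst⟫ := by
  rw [helmholtz, Submodule.inner_starProjection_left_eq_right,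
    Submodule.starProjection_eq_self_iff.2 (fst_mem_H v)]

end Operators

/-! ### The dual norm under the Poincaré inequality. -/

section NegNorm

variable {Ω : Opens E3} {lam : ℝ}

theorem PoincareInequality.norm_fst_le (hΩ : PoincareInequality Ω lam) (hlam : 0 < lam)
    (φ : H10 Ω) : ‖φ.1.fst‖ ≤ (√lam)⁻¹ * ‖φ.1.snd‖ := by
  refine abs_le_of_sq_le_sq' ?_ (by positivity) |>.2
  rw [mul_pow, inv_pow, Real.sq_sqrt hlam.le, ← div_eq_inv_mul, le_div_iff₀ hlam]
  linarith [hΩ φ]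

theorem PoincareInequality.inner_le (hΩ : PoincareInequality Ω lam) (hlam : 0 < lam)
    (g : L2 Ω E3) {φ : H10 Ω} (hφ : ‖φ.1.snd‖ ≤ 1) : ⟪g, φ.1.fst⟫ ≤ (√lam)⁻¹ * ‖g‖ := by
  have h1 := hΩ.norm_fst_le hlam φ
  calc ⟪g, φ.1.fst⟫ ≤ ‖g‖ * ‖φ.1.fst‖ := real_inner_le_norm _ _
    _ ≤ ‖g‖ * ((√lam)⁻¹ * 1) := by
      gcongr
      exact h1.trans (by gcongr)
    _ = _ := by ring

/-- The Poincaré inequality bounds the set above, so `sSup` is a genuine supremum and not a default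
value. -/
theorem PoincareInequality.le_negNorm (hΩ : PoincareInequality Ω lam) (hlam : 0 < lam)
    (g : L2 Ω E3) {φ : H10 Ω} (hφ : ‖φ.1.snd‖ ≤ 1) : ⟪g, φ.1.fst⟫ ≤ negNorm Ω g := by
  refine le_csSup ⟨(√lam)⁻¹ * ‖g‖, ?_⟩ ⟨φ, hφ, rfl⟩
  rintro r ⟨ψ, hψ, rfl⟩
  exact hΩ.inner_le hlam g hψ

theorem negNorm_le {g : L2 Ω E3} {C : ℝ}
    (h : ∀ φ : H10 Ω, ‖φ.1.snd‖ ≤ 1 → ⟪g, φ.1.fst⟫ ≤ C) : negNorm Ω g ≤ C := by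
  refine csSup_le ⟨_, 0, ?_, rfl⟩ ?_
  · simp
  · rintro r ⟨ψ, hψ, rfl⟩
    exact h ψ hψ

/-- Serves to make `s ↦ negNorm Ω (f s)` measurable and square integrable in time. -/
theorem PoincareInequality.lipschitzWith_negNorm (hΩ : PoincareInequality Ω lam)
    (hlam : 0 < lam) : LipschitzWith ((√lam)⁻¹).toNNReal (negNorm Ω) := by
  refine LipschitzWith.of_le_add_mul _ fun g g' => negNorm_le fun φ hφ => ?_
  rw [Real.coe_toNNReal _ (by positivity), dist_eq_norm]
  have h1 := hΩ.le_negNorm hlam g' hφ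
  have h2 := hΩ.inner_le hlam (g - g') hφ
  rw [inner_sub_left] at h2
  linarith

theorem PoincareInequality.inner_le_negNorm_mul (hΩ : PoincareInequality Ω lam) (hlam : 0 < lam)
    (g : L2 Ω E3) (φ : H10 Ω) : ⟪g, φ.1.fst⟫ ≤ negNorm Ω g * ‖φ.1.snd‖ := by
  -- A field with zero gradient cannot be normalised, but the Poincaré inequality forces it to
  -- vanish.
  rcases eq_or_lt_of_le (norm_nonneg φ.1.snd) with h | h
  · have h1 := hΩ.norm_fst_le hlam φ
    rw [← h, mul_zero] at h1
    have h2 : φ.1.fst = 0 := norm_eq_zero.1 (le_antisymm h1 (norm_nonneg _))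
    rw [← h, h2, inner_zero_right, mul_zero]
  · have h1 : ‖((‖φ.1.snd‖⁻¹ • φ : H10 Ω)).1.snd‖ ≤ 1 := by
      rw [Submodule.coe_smul, WithLp.smul_snd, norm_smul, norm_inv, norm_norm,
        inv_mul_cancel₀ h.ne']
    have h2 := hΩ.le_negNorm hlam g h1
    rw [Submodule.coe_smul, WithLp.smul_fst, real_inner_smul_right, inv_mul_le_iff₀ h] at h2
    linarith

theorem V_le_H10 (Ω : Opens E3) : V Ω ≤ H10 Ω :=
  Submodule.topologicalClosure_mono fun _ ⟨φ, _, h⟩ => ⟨φ, trivial, h⟩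

end NegNorm

/-! ### The energy inequality with exponential weight. -/

section WeightedEnergy

variable {V H : Type*} [NormedAddCommGroup V] [InnerProductSpace ℝ V] [CompleteSpace V]
  [NormedAddCommGroup H] [InnerProductSpace ℝ H] [CompleteSpace H] {j : V →L[ℝ] H} {ν a b : ℝ}

theorem IsLinearSolution.exp_mul_norm_sq_eq {u₀ : H} {h : ℝ → V} {u : ℝ → H} {U : ℝ → V}
    (hν : 0 < ν) (hab : a ≤ b) (s : IsLinearSolution j ν a b u₀ h u U)
    (hu₀ : u₀ ∈ closure (Set.range j)) (hh : MemLp h 2 (volume.restrict (Ioc a b))) (c : ℝ) :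
    Real.exp (c * b) * ‖u b‖ ^ 2 = Real.exp (c * a) * ‖u₀‖ ^ 2 + ∫ r in a..b,
      Real.exp (c * r) * (2 * ⟪h r, U r⟫ - 2 * ν * ‖U r‖ ^ 2 + c * ‖u r‖ ^ 2) := by
  have i1 := memLp_integrable_inner hh s.memLp
  have i2 := memLp_integrable_norm_sq s.memLp
  have hb := right_mem_Icc.2 hab
  have hφ := intervalIntegrable_of_mem_Icc ((i1.const_mul 2).sub (i2.const_mul (2 * ν))) hb
  refine exp_mul_eq (y := fun t => ‖u t‖ ^ 2) c hφ fun t ht => ?_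
  rw [uIcc_of_le hab] at ht
  have e := s.energyEquality hν hab hu₀ hh t ht
  simp only [real_inner_self_eq_norm_sq] at e
  have h1 := intervalIntegral.integral_sub
    ((intervalIntegrable_of_mem_Icc i1 ht).const_mul 2)
    ((intervalIntegrable_of_mem_Icc i2 ht).const_mul (2 * ν))
  simp only [intervalIntegral.integral_const_mul] at h1
  rw [h1]
  linarith

/-- The energy equality with integrating factor `exp (c t)`, bounded pointwise under the integral.
The hypothesis involves `j (U r)` instead of `u r`, as the two agree only almost everywhere. -/
theorem IsLinearSolution.weighted_energy_le {u₀ : H} {h : ℝ → V} {u : ℝ → H} {U : ℝ → V}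
    (hν : 0 < ν) (hab : a ≤ b) (s : IsLinearSolution j ν a b u₀ h u U)
    (hu₀ : u₀ ∈ closure (Set.range j)) (hh : MemLp h 2 (volume.restrict (Ioc a b)))
    {c α β : ℝ} {D ψ : ℝ → ℝ} (hD : Integrable D (volume.restrict (Ioc a b)))
    (hψ : Integrable ψ (volume.restrict (Ioc a b)))
    (hle : ∀ r, 2 * ⟪h r, U r⟫ - 2 * ν * ‖U r‖ ^ 2 + c * ‖j (U r)‖ ^ 2 ≤ β * ψ r - α * D r) :
    ‖u b‖ ^ 2 + α * ∫ r in a..b, Real.exp (-c * (b - r)) * D r ≤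
      Real.exp (-c * (b - a)) * ‖u₀‖ ^ 2 + β * ∫ r in a..b, Real.exp (-c * (b - r)) * ψ r := by
  have hb := right_mem_Icc.2 hab
  have hexp : ∀ r, Real.exp (-c * (b - r)) = Real.exp (-(c * b)) * Real.exp (c * r) := fun r => by
    rw [← Real.exp_add]
    ring_nf
  have hce : ContinuousOn (fun r => Real.exp (c * r)) (uIcc a b) := by fun_prop
  have iD := (intervalIntegrable_of_mem_Icc hD hb).continuousOn_mul hce
  have iψ := (intervalIntegrable_of_mem_Icc hψ hb).continuousOn_mul hce
  have i1 := memLp_integrable_inner hh s.memLp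
  have i2 := memLp_integrable_norm_sq s.memLp
  have i3 := memLp_integrable_norm_sq (memLp_clm j s.memLp)
  have e := s.exp_mul_norm_sq_eq hν hab hu₀ hh c
  have h1 : ∫ r in a..b, Real.exp (c * r) *
      (2 * ⟪h r, U r⟫ - 2 * ν * ‖U r‖ ^ 2 + c * ‖u r‖ ^ 2) =
      ∫ r in a..b, Real.exp (c * r) *
        (2 * ⟪h r, U r⟫ - 2 * ν * ‖U r‖ ^ 2 + c * ‖j (U r)‖ ^ 2) :=
    integral_congr_Icc (s.ae_eq.mono fun r hr => by rw [hr]) hb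
  have h2 : ∫ r in a..b, Real.exp (c * r) *
        (2 * ⟪h r, U r⟫ - 2 * ν * ‖U r‖ ^ 2 + c * ‖j (U r)‖ ^ 2) ≤
      ∫ r in a..b, (β * (Real.exp (c * r) * ψ r) - α * (Real.exp (c * r) * D r)) := by
    refine intervalIntegral.integral_mono_on hab
      ((intervalIntegrable_of_mem_Icc (((i1.const_mul 2).sub (i2.const_mul (2 * ν))).add
        (i3.const_mul c)) hb).continuousOn_mul hce)
      ((iψ.const_mul β).sub (iD.const_mul α)) fun r _ => ?_
    calc _ ≤ Real.exp (c * r) * (β * ψ r - α * D r) :=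
          mul_le_mul_of_nonneg_left (hle r) (Real.exp_pos _).le
      _ = _ := by ring
  rw [intervalIntegral.integral_sub (iψ.const_mul β) (iD.const_mul α)] at h2
  simp only [intervalIntegral.integral_const_mul] at h2
  simp only [hexp, mul_assoc, intervalIntegral.integral_const_mul]
  rw [h1] at e
  have h3 : Real.exp (c * b) * ‖u b‖ ^ 2 + α * (∫ r in a..b, Real.exp (c * r) * D r) ≤
      Real.exp (c * a) * ‖u₀‖ ^ 2 + β * ∫ r in a..b, Real.exp (c * r) * ψ r := by linarith
  have h4 := mul_le_mul_of_nonneg_left h3 (Real.exp_pos (-(c * b))).le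
  have h5 : Real.exp (-(c * b)) * Real.exp (c * b) = 1 := by
    rw [← Real.exp_add, neg_add_cancel, Real.exp_zero]
  calc _ = Real.exp (-(c * b)) * Real.exp (c * b) * ‖u b‖ ^ 2 +
        α * (Real.exp (-(c * b)) * ∫ r in a..b, Real.exp (c * r) * D r) := by rw [h5, one_mul]
    _ = Real.exp (-(c * b)) * (Real.exp (c * b) * ‖u b‖ ^ 2 +
        α * (∫ r in a..b, Real.exp (c * r) * D r)) := by ring
    _ ≤ _ := h4
    _ = _ := by ring

end WeightedEnergy

/-! ### Weak solutions as solutions of the abstract problem. -/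

section WeakSolution

theorem mul_integral_sub_integral {F₀ F₁ F₂ F₃ A B : ℝ → ℝ} {ν a t : ℝ}
    (h₀ : IntervalIntegrable F₀ volume a t) (h₁ : IntervalIntegrable F₁ volume a t)
    (h₂ : IntervalIntegrable F₂ volume a t) (h₃ : IntervalIntegrable F₃ volume a t)
    (hA : ∀ s, A s = F₀ s + F₁ s) (hB : ∀ s, B s = F₃ s - (F₂ s - ν * F₀ s)) :
    ν * (∫ s in a..t, A s) - ∫ s in a..t, B s =
      ν * (∫ s in a..t, F₁ s) + (∫ s in a..t, F₂ s) - ∫ s in a..t, F₃ s := by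
  simp only [hA, hB]
  rw [intervalIntegral.integral_add h₀ h₁,
    intervalIntegral.integral_sub h₃ (h₂.sub (h₀.const_mul ν)),
    intervalIntegral.integral_sub h₂ (h₀.const_mul ν), intervalIntegral.integral_const_mul]
  ring

theorem ae_restrict_Ioi_of_forall_Ioc {τ : ℝ} {p : ℝ → Prop}
    (h : ∀ n : ℕ, ∀ᵐ t ∂volume.restrict (Ioc τ (τ + n)), p t) :
    ∀ᵐ t ∂volume.restrict (Ioi τ), p t := by
  rw [ae_restrict_iff' measurableSet_Ioi]
  have h1 : ∀ᵐ t ∂(volume : Measure ℝ), ∀ n : ℕ, t ∈ Ioc τ (τ + n) → p t :=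
    ae_all_iff.2 fun n => (ae_restrict_iff' measurableSet_Ioc).1 (h n)
  filter_upwards [h1] with t ht htτ
  exact ht ⌈t - τ⌉₊ ⟨htτ, by linarith [Nat.le_ceil (t - τ)]⟩

variable {Ω : Opens E3} {ν N τ : ℝ} {f : ℝ → L2 Ω E3} {u₀ : H Ω} {u : ℝ → H Ω} {U : ℝ → V Ω}

/-- The right-hand side of the linear problem that a weak solution solves. -/
noncomputable def weakData (ν N : ℝ) (f : ℝ → L2 Ω E3) (U : ℝ → V Ω) (t : ℝ) : V Ω :=
  forcing Ω (f t) - nonlinearity Ω ν N (U t)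

theorem memLp_nonlinearity (hN : 0 < N) {b : ℝ} (hU : MemLp U 2 (volume.restrict (Ioc τ b))) :
    MemLp (fun t => nonlinearity Ω ν N (U t)) 2 (volume.restrict (Ioc τ b)) := by
  obtain ⟨K, hK⟩ := (isLowerOrder_nonlinearity (Ω := Ω) ν hN).lipschitz
  exact memLp_lipschitz_comp hK hU

/-- The full H¹ inner product adds `ν ∫ (u, v)` on the left, and the zero-order part of
`nonlinearity` adds the same on the right. -/
theorem weak_equation_iff (hN : 0 < N) {b t : ℝ} (ht : t ∈ Icc τ b)
    (hf : MemLp f 2 (volume.restrict (Ioc τ b))) (hU : MemLp U 2 (volume.restrict (Ioc τ b)))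
    (x y : ℝ) (v : V Ω) :
    x + ν * (∫ s in τ..t, inner ℝ (U s).1.snd v.1.snd)
        + (∫ s in τ..t, cutoff N (normL4 (U s).1.fst) * trilinear (U s) (U s) v)
      = y + ∫ s in τ..t, inner ℝ (helmholtz Ω (f s)) v.1.fst ↔
    x + ν * (∫ s in τ..t, ⟪U s, v⟫) = y + ∫ s in τ..t, ⟪weakData ν N f U s, v⟫ := by
  have hG := memLp_nonlinearity (ν := ν) hN hU
  have i₀ : IntervalIntegrable (fun s => ⟪(U s).1.fst, v.1.fst⟫) volume τ t :=
    intervalIntegrable_of_mem_Icc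
      ((integrable_of_memLp_two (memLp_clm (valueL2 Ω) hU)).inner_const v.1.fst) ht
  have i₁ : IntervalIntegrable (fun s => ⟪(U s).1.snd, v.1.snd⟫) volume τ t :=
    intervalIntegrable_of_mem_Icc
      ((integrable_of_memLp_two (memLp_clm (gradL2 Ω) hU)).inner_const v.1.snd) ht
  have i₃ : IntervalIntegrable (fun s => ⟪f s, v.1.fst⟫) volume τ t :=
    intervalIntegrable_of_mem_Icc ((integrable_of_memLp_two hf).inner_const v.1.fst) ht
  have i₄ : IntervalIntegrable (fun s => ⟪nonlinearity Ω ν N (U s), v⟫) volume τ t :=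
    intervalIntegrable_of_mem_Icc ((integrable_of_memLp_two hG).inner_const v) ht
  have i₂ : IntervalIntegrable
      (fun s => cutoff N (normL4 (U s).1.fst) * trilinear (U s) (U s) v) volume τ t := by
    refine (i₄.add (i₀.const_mul ν)).congr (fun s _ => ?_)
    simp only [inner_nonlinearity]
    ring
  have h := mul_integral_sub_integral (ν := ν) (A := fun s => ⟪U s, v⟫)
    (B := fun s => ⟪weakData ν N f U s, v⟫) i₀ i₁ i₂ i₃ (fun s => inner_V _ _) (fun s => by
      rw [weakData, inner_sub_left, inner_nonlinearity, inner_forcing])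
  simp only [inner_helmholtz]
  constructor <;> intro h' <;> linarith

theorem IsWeakSolution.isLinearSolution (hN : 0 < N)
    (hf : ∀ b, MemLp f 2 (volume.restrict (Ioc τ b))) (s : IsWeakSolution Ω ν N τ f u₀ u U)
    (b : ℝ) : IsLinearSolution (valueH Ω) ν τ b u₀ (weakData ν N f U) u U where
  continuousOn := s.continuousOn.mono Icc_subset_Ici_self
  memLp := s.memLp b
  ae_eq := by
    filter_upwards [ae_restrict_of_ae_restrict_of_subset Ioc_subset_Ioi_self s.ae_eq] with t ht
    exact Subtype.ext ht
  initial := s.initial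
  equation v t ht :=
    (weak_equation_iff hN ht (hf b) (s.memLp b) _ _ v).1 (s.equation v t ht.1)

theorem isWeakSolution_of_isLinearSolution (hN : 0 < N)
    (hf : ∀ b, MemLp f 2 (volume.restrict (Ioc τ b)))
    (s : ∀ b, τ ≤ b → IsLinearSolution (valueH Ω) ν τ b u₀ (weakData ν N f U) u U) :
    IsWeakSolution Ω ν N τ f u₀ u U where
  continuousOn t ht := by
    refine ((s (t + 1) (by linarith [mem_Ici.1 ht])).continuousOn t
      ⟨ht, by linarith⟩).mono_of_mem_nhdsWithin ?_
    rw [← Ici_inter_Iic]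
    exact inter_mem self_mem_nhdsWithin (mem_nhdsWithin_of_mem_nhds (Iic_mem_nhds (by linarith)))
  memLp T := by
    rcases le_total τ T with h | h
    · exact (s T h).memLp
    · rw [Ioc_eq_empty (not_lt.2 h), Measure.restrict_empty]
      exact ⟨aestronglyMeasurable_zero_measure _, by simp⟩
  ae_eq := ae_restrict_Ioi_of_forall_Ioc fun n =>
    (s (τ + n) (le_add_of_nonneg_right n.cast_nonneg)).ae_eq.mono fun t ht =>
      congrArg Subtype.val ht
  initial := (s τ le_rfl).initial
  equation v t ht :=
    (weak_equation_iff hN (right_mem_Icc.2 ht) (hf t) (s t ht).memLp _ _ v).2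
      ((s t ht).equation v t (right_mem_Icc.2 ht))

theorem two_mul_mul_le (hν : 0 < ν) (n q : ℝ) :
    2 * (n * q) ≤ 2 / ν * n ^ 2 + ν / 2 * q ^ 2 := by
  have h4 : 2 / ν * n ^ 2 + ν / 2 * q ^ 2 - 2 * (n * q) = (2 * n - ν * q) ^ 2 / (2 * ν) := by
    field_simp
    ring
  have h5 : 0 ≤ (2 * n - ν * q) ^ 2 / (2 * ν) := by positivity
  linarith

/-- Here `p`, `q`, `n` stand for the norms of the field, its gradient and the force. The zero-order
terms cancel, leaving dissipation `2ν q²`: Young's inequality takes `ν/2 q²`, the Poincaré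
inequality `ν q²`, and `ν/2 q²` remains. -/
theorem energy_balance_le {lam I i k c m p q r n z : ℝ} (hν : 0 < ν) (h1 : i ≤ n * q)
    (h2 : lam * p ^ 2 ≤ q ^ 2) (hI : I = i - k) (hk : k = c * z - ν * r) (hz : z = 0)
    (hr : r = p ^ 2) (hm : m ^ 2 = p ^ 2 + q ^ 2) :
    2 * I - 2 * ν * m ^ 2 + ν * lam * p ^ 2 ≤ 2 / ν * n ^ 2 - ν / 2 * q ^ 2 := by
  have h3 := two_mul_mul_le hν n q
  have h6 := mul_le_mul_of_nonneg_left h2 hν.le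
  subst hI hk hz hr
  rw [hm]
  linarith

theorem energy_pointwise_le {lam : ℝ} (hlam : 0 < lam) (hΩ : PoincareInequality Ω lam)
    (hν : 0 < ν) (g : L2 Ω E3) (W : V Ω) :
    2 * ⟪forcing Ω g - nonlinearity Ω ν N W, W⟫ - 2 * ν * ‖W‖ ^ 2
        + ν * lam * ‖valueH Ω W‖ ^ 2 ≤
      2 / ν * negNorm Ω g ^ 2 - ν / 2 * ‖W.1.snd‖ ^ 2 :=
  energy_balance_le hν (hΩ.inner_le_negNorm_mul hlam g ⟨W.1, V_le_H10 Ω W.2⟩)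
    (hΩ ⟨W.1, V_le_H10 Ω W.2⟩)
    ((inner_sub_left _ _ _).trans (congrArg (· - _) (inner_forcing g W)))
    (inner_nonlinearity ν N W W) (trilinear_self W W) (real_inner_self_eq_norm_sq _)
    (norm_sq_V W)

end WeakSolution

end GMNS

/-! ### The main theorem. -/

open GMNS in
theorem theoremA2 (Ω : TopologicalSpace.Opens GMNS.E3) (lam : ℝ) (hlam : 0 < lam)
    (hΩ : GMNS.PoincareInequality Ω lam) (ν N : ℝ) (hν : 0 < ν) (hN : 0 < N) (τ : ℝ)
    (u₀ : GMNS.H Ω) (f : ℝ → GMNS.L2 Ω GMNS.E3)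
    (hf : ∀ a b : ℝ, MemLp f 2 (volume.restrict (Set.Icc a b))) :
    ∃ (u : ℝ → GMNS.H Ω) (U : ℝ → GMNS.V Ω),
      GMNS.IsWeakSolution Ω ν N τ f u₀ u U ∧
      (∀ (u' : ℝ → GMNS.H Ω) (U' : ℝ → GMNS.V Ω), GMNS.IsWeakSolution Ω ν N τ f u₀ u' U' →
        (∀ t, τ ≤ t → u' t = u t) ∧ ∀ᵐ t ∂volume.restrict (Set.Ioi τ), U' t = U t) ∧
      ∀ t, τ ≤ t →
        ‖u t‖ ^ 2
            + ν / 2 * ∫ s in τ..t, Real.exp (-ν * lam * (t - s)) * ‖(U s).1.snd‖ ^ 2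
          ≤ Real.exp (-ν * lam * (t - τ)) * ‖u₀‖ ^ 2
            + 2 / ν * ∫ s in τ..t,
                Real.exp (-ν * lam * (t - s)) * GMNS.negNorm Ω (f s) ^ 2 := by
  have hf' : ∀ b, MemLp f 2 (volume.restrict (Set.Ioc τ b)) := fun b =>
    (hf τ b).mono_measure (Measure.restrict_mono Set.Ioc_subset_Icc_self le_rfl)
  have hg : ∀ b, MemLp (fun t => forcing Ω (f t)) 2 (volume.restrict (Set.Ioc τ b)) := fun b =>
    memLp_clm (forcing Ω) (hf' b)
  have hG := isLowerOrder_nonlinearity (Ω := Ω) ν hN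
  have hu₀ := mem_closure_range_valueH u₀
  obtain ⟨u, U, s⟩ := exists_global_semilinearSolution hG hν hu₀ hg
  refine ⟨u, U, isWeakSolution_of_isLinearSolution hN hf' s, fun u' U' s' => ?_, fun t ht => ?_⟩
  · have huniq := fun b (hb : τ ≤ b) =>
      (s'.isLinearSolution hN hf' b).semilinear_unique hG hν hb (hg b) (s b hb)
    exact ⟨fun t ht => (huniq t ht).1 t (Set.right_mem_Icc.2 ht),
      ae_restrict_Ioi_of_forall_Ioc fun n =>
        (huniq (τ + n) (le_add_of_nonneg_right n.cast_nonneg)).2⟩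
  · have hU := (s t ht).memLp
    have hneg := memLp_lipschitz_comp (hΩ.lipschitzWith_negNorm hlam) (hf' t)
    have h := (s t ht).weighted_energy_le hν ht hu₀ ((hg t).sub (memLp_nonlinearity hN hU))
      (c := ν * lam) (D := fun r => ‖(U r).1.snd‖ ^ 2) (ψ := fun r => negNorm Ω (f r) ^ 2)
      (memLp_integrable_norm_sq (memLp_clm (gradL2 Ω) hU)) hneg.integrable_sq
      fun r => energy_pointwise_le hlam hΩ hν (f r) (U r)
    rw [← neg_mul] at h
    exact h
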